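/- Let $g,\delta\ge 0$ be integers and let $\mathbb R\langle x_1,\dots,x_g\rangle$ be the free algebra of noncommutative polynomials, with the linear involution ${}^T$ that reverses words and fixes each $x_j$. For $n\ge 1$ let $\mathbb S_n(\mathbb R^g)$ be the space of $g$-tuples $X=(X_1,\dots,X_g)$ of real symmetric $n\times n$ matrices. A matrix polynomial $p=\sum_w p_w w$ with coefficients $p_w\in\mathbb R^{\delta\times\delta}$ is evaluated at $X$ by $p(X)=\sum_w p_w\otimes w(X)$; it is symmetric if $p=p^T:=\sum_w p_w^T w^T$, and $p(0)$ denotes its constant term, a $\delta\times\delta$ matrix. If $p(0)$ is invertible, let $\mathcal D_p(n)$ be the connected component of $0$ in $\{X\in\mathbb S_n(\mathbb R^g): p(X)\text{ is invertible}\}$. **Theorem.** Let $p$ be a symmetric $\delta\times\delta$ matrix of noncommutative polynomials in $x_1,\dots,x_g$ such that 1. $p(0)$ is invertible; 2. $\mathcal D_p$ is bounded: there is a constant $K$ with $\sum_{j}\|X_j\|\le K$ (operator norms) for all $n\ge1$ and all $X\in\mathcal D_p(n)$; 3. $\mathcal D_p$ is convex: $\mathcal D_p(n)$ is a convex set for every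 $n\ge 1$. Then there are an integer $\ell\ge1$ and real symmetric $\ell\times\ell$ matrices $A_1,\dots,A_g$ such that the monic affine linear pencil $L=I_\ell+\sum_{j}A_jx_j$ satisfies, for every $n\ge1$, $$\mathcal D_p(n)=\mathcal D_L(n)=\{X\in\mathbb S_n(\mathbb R^g): L(X)\succ0\},$$ and $L(X)=I_\ell\otimes I_n+\sum_j A_j\otimes X_j$ has a nonzero kernel for every $X$ in the boundary of $\mathcal D_p(n)$ in $\mathbb S_n(\mathbb R^g)$. In particular, $L$ is positive definite on $\mathcal D_p$. -/

import Mathlib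

noncomputable section

/-- The algebra of noncommutative polynomials in the symmetric variables `x_1, …, x_g`.
Mathlib's `star` on it is the real-linear involution that reverses words and fixes each `x_j`. -/
abbrev NCPoly (g : ℕ) : Type := FreeAlgebra ℝ (Fin g)

/-- The `δ × δ` matrices of noncommutative polynomials. The entries of `pᴴ` are
`(pᴴ) i j = star (p j i)`, so `p.IsHermitian` says that `p` is symmetric for the involution
`p = ∑ p_w w ↦ ∑ (p_w)ᵀ wᵀ`. -/
abbrev NCMatPoly (g δ : ℕ) : Type := Matrix (Fin δ) (Fin δ) (NCPoly g)

/-- The space of `g`-tuples of real symmetric `n × n` matrices, with its usual vector space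
structure and topology. -/
def SymTuple (g n : ℕ) : Submodule ℝ (Fin g → Matrix (Fin n) (Fin n) ℝ) where
  carrier := {X | ∀ j, (X j).IsSymm}
  add_mem' hX hY j := (hX j).add (hY j)
  zero_mem' _ := Matrix.isSymm_zero
  smul_mem' c _ hX j := (hX j).smul c

/-- The evaluation `p(X) = ∑ p_w ⊗ w(X)`: the `δ × δ` block matrix whose `(i, j)` block is the
`n × n` matrix obtained by substituting `X` in the entry `p i j`. -/
def ncEval {g δ n : ℕ} (p : NCMatPoly g δ) (X : SymTuple g n) :
    Matrix (Fin δ × Fin n) (Fin δ × Fin n) ℝ :=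
  Matrix.of fun a b => FreeAlgebra.lift ℝ X.1 (p a.1 b.1) a.2 b.2

/-- The constant term `p(0)`, a real `δ × δ` matrix. -/
def constTerm {g δ : ℕ} (p : NCMatPoly g δ) : Matrix (Fin δ) (Fin δ) ℝ :=
  p.map (FreeAlgebra.lift ℝ fun _ : Fin g => (0 : ℝ))

/-- The invertibility set of `p` in dimension `n`: the connected component of `0` in the set of
`X` such that `p(X)` is invertible. -/
def invertibilitySet {g δ : ℕ} (p : NCMatPoly g δ) (n : ℕ) : Set (SymTuple g n) :=
  connectedComponentIn {X : SymTuple g n | IsUnit (ncEval p X)} 0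

/-- `‖X‖ = ∑ ‖X_j‖`, with the operator norm for the Euclidean norm on `ℝⁿ`. -/
def tupleNorm {g n : ℕ} (X : SymTuple g n) : ℝ :=
  ∑ j, ‖Matrix.toEuclideanCLM (n := Fin n) (𝕜 := ℝ) (X.1 j)‖

/-- The invertibility set is bounded, by one constant for all dimensions. -/
def HasBoundedInvertibilitySet {g δ : ℕ} (p : NCMatPoly g δ) : Prop :=
  ∃ K : ℝ, ∀ n : ℕ, 1 ≤ n → ∀ X ∈ invertibilitySet p n, tupleNorm X ≤ K

/-- The invertibility set is convex in each dimension. -/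
def HasConvexInvertibilitySet {g δ : ℕ} (p : NCMatPoly g δ) : Prop :=
  ∀ n : ℕ, 1 ≤ n → Convex ℝ (invertibilitySet p n)

/-- The monic affine linear pencil `I + ∑ A_j x_j`, as a matrix of noncommutative polynomials. -/
def monicPencil {g l : ℕ} (A : Fin g → Matrix (Fin l) (Fin l) ℝ) : NCMatPoly g l :=
  1 + ∑ j, (A j).map fun a => a • FreeAlgebra.ι ℝ j

end

open Matrix Kronecker

/-! Convexity at every size forces matrix convexity. If `W` is an isometry and `U = 2WWᵀ - 1` the
reflection in its range, then the midpoint of `Y` and `UYU` commutes with `WWᵀ` and restricts to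
`WᵀYW` on that range. So `D_p` is closed under isometric compressions (`conjTuple_mem_of_isometry`),
and under direct sums. An Effros–Winkler argument then turns a separating functional into a form
`tr(T VᵀV) - ∑ tr(Λ_j Vᵀ Y_j V)`, nonnegative for every `Y` in the closure of `D_p` at every size
(`exists_dominating_form`).

A single pencil must be singular on the whole boundary. Take a closure point `X` with `p(X)v = 0`,
`v ≠ 0`, let `d` bound the degree of `p`, and let `P` project onto `{q(X)v : deg q ≤ d}`. Then
`p(PXP)v = p(X)v = 0`, so `PXP` lies outside `D_p`. Separating it gives `T ≠ 0` and `Λ_j` with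
ranges in that of `P`, for which `V = 1` at `Y = X` is a zero, hence a minimum, of the form. Its
first variation is `T = ∑ X_j Λ_j` (`exists_separating_form`).

This identity transfers to another pair `(Y, w)`. If every row `q` of degree at most `d + 1` killing
`(X, v)` also kills `(Y, w)`, there is a linear `R` with `R q(X)v = q(Y)w`, and `RT = ∑ Y_j R Λ_j`.
After normalising `T` to the identity, this is a kernel vector of the pencil at `Y` unless `RT = 0`.
Direct sums provide such a dominating pair `(X, v)`. The pairs with `RT = 0` are killed by
additional rows of degree at most `d`, a finite-dimensional space, so induction on codimension ends
with a finite direct sum of pencils (`exists_pencil_of_annihilatedPairs`).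

The resulting pencil is nonnegative on the closure of `D_p` and singular on its boundary;
connectedness identifies the sets. -/

/-! ### Evaluation, intertwining and continuity -/

theorem lift_mul_of_intertwine {g m n : ℕ} {Z : Fin g → Matrix (Fin m) (Fin m) ℝ}
    {X : Fin g → Matrix (Fin n) (Fin n) ℝ} {E : Matrix (Fin m) (Fin n) ℝ}
    (h : ∀ j, Z j * E = E * X j) (q : NCPoly g) :
    FreeAlgebra.lift ℝ Z q * E = E * FreeAlgebra.lift ℝ X q := by
  induction q using FreeAlgebra.induction with
  | grade0 r => simp [Algebra.algebraMap_eq_smul_one]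
  | grade1 x => simpa using h x
  | mul a b ha hb => rw [map_mul, map_mul, Matrix.mul_assoc, hb, ← Matrix.mul_assoc, ha,
      Matrix.mul_assoc]
  | add a b ha hb => rw [map_add, map_add, Matrix.add_mul, ha, hb, Matrix.mul_add]

theorem ncEval_mul_of_intertwine {g δ m n : ℕ} (p : NCMatPoly g δ) {Z : SymTuple g m}
    {X : SymTuple g n} {E : Matrix (Fin m) (Fin n) ℝ} (h : ∀ j, Z.1 j * E = E * X.1 j) :
    ncEval p Z * ((1 : Matrix (Fin δ) (Fin δ) ℝ) ⊗ₖ E) =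
      ((1 : Matrix (Fin δ) (Fin δ) ℝ) ⊗ₖ E) * ncEval p X := by
  ext ⟨i, a⟩ ⟨j, b⟩
  have := congrFun (congrFun (lift_mul_of_intertwine h (p i j)) a) b
  simpa [ncEval, Matrix.mul_apply, Fintype.sum_prod_type, Matrix.one_apply, Finset.sum_ite_eq,
    ite_mul, mul_ite, Finset.sum_ite_irrel] using this

/-- Compression of a tuple: `X ↦ Vᵀ X V`. -/
def conjTuple {g m n : ℕ} (V : Matrix (Fin m) (Fin n) ℝ) : SymTuple g m →ₗ[ℝ] SymTuple g n where
  toFun X := ⟨fun j => Vᵀ * X.1 j * V, fun j => by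
    have h : (X.1 j)ᵀ = X.1 j := X.2 j
    simp [Matrix.IsSymm, Matrix.transpose_mul, h, Matrix.mul_assoc]⟩
  map_add' X Y := by ext; simp [Matrix.mul_add, Matrix.add_mul]
  map_smul' c X := by ext; simp

@[simp] theorem conjTuple_apply {g m n : ℕ} (V : Matrix (Fin m) (Fin n) ℝ) (X : SymTuple g m)
    (j : Fin g) : (conjTuple V X).1 j = Vᵀ * X.1 j * V := rfl

theorem continuous_conjTuple {g m n : ℕ} (V : Matrix (Fin m) (Fin n) ℝ) :
    Continuous (conjTuple V : SymTuple g m →ₗ[ℝ] SymTuple g n) := by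
  refine Continuous.subtype_mk (continuous_pi fun j => ?_) _
  have : Continuous fun X : SymTuple g m => X.1 j :=
    (continuous_apply j).comp continuous_subtype_val
  exact (continuous_const.matrix_mul this).matrix_mul continuous_const

theorem continuous_lift {g n : ℕ} (q : NCPoly g) :
    Continuous fun X : SymTuple g n => FreeAlgebra.lift ℝ X.1 q := by
  induction q using FreeAlgebra.induction with
  | grade0 r => simpa using continuous_const
  | grade1 x =>
    simp only [FreeAlgebra.lift_ι_apply]
    exact (continuous_apply x).comp continuous_subtype_val
  | mul a b ha hb =>
    simp only [map_mul]
    exact ha.mul hb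
  | add a b ha hb =>
    simp only [map_add]
    exact ha.add hb

theorem continuous_ncEval {g δ n : ℕ} (p : NCMatPoly g δ) :
    Continuous fun X : SymTuple g n => ncEval p X :=
  continuous_matrix fun a b => (continuous_lift (p a.1 b.1)).matrix_elem a.2 b.2

/-! ### Topology of the invertibility set -/

theorem isOpen_isUnit_ncEval {g δ : ℕ} (p : NCMatPoly g δ) (n : ℕ) :
    IsOpen {X : SymTuple g n | IsUnit (ncEval p X)} := by
  simp only [Matrix.isUnit_iff_isUnit_det, isUnit_iff_ne_zero]
  exact isOpen_ne_fun (continuous_ncEval p).matrix_det continuous_const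

instance (n : ℕ) : LocallyConvexSpace ℝ (Matrix (Fin n) (Fin n) ℝ) :=
  inferInstanceAs (LocallyConvexSpace ℝ (Fin n → Fin n → ℝ))

theorem isOpen_invertibilitySet {g δ : ℕ} (p : NCMatPoly g δ) (n : ℕ) :
    IsOpen (invertibilitySet p n) :=
  (isOpen_isUnit_ncEval p n).connectedComponentIn

theorem isUnit_ncEval_zero {g δ : ℕ} {p : NCMatPoly g δ} (hp0 : IsUnit (constTerm p)) (n : ℕ) :
    IsUnit (ncEval p (0 : SymTuple g n)) := by
  have h : ∀ q : NCPoly g, FreeAlgebra.lift ℝ (0 : Fin g → Matrix (Fin n) (Fin n) ℝ) q =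
      FreeAlgebra.lift ℝ (fun _ : Fin g => (0 : ℝ)) q • (1 : Matrix (Fin n) (Fin n) ℝ) := by
    intro q
    induction q using FreeAlgebra.induction with
    | grade0 r => simp [Algebra.algebraMap_eq_smul_one]
    | grade1 x => simp
    | mul a b ha hb => rw [map_mul, ha, hb, map_mul, smul_mul_smul_comm, one_mul]
    | add a b ha hb => rw [map_add, ha, hb, map_add, add_smul]
  have h' : ncEval p (0 : SymTuple g n) = constTerm p ⊗ₖ (1 : Matrix (Fin n) (Fin n) ℝ) := by
    ext ⟨i, a⟩ ⟨j, b⟩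
    simp [ncEval, h, constTerm, Matrix.one_apply]
  obtain ⟨u, hu⟩ := hp0
  refine (IsUnit.of_mul_eq_one
    ( (↑u⁻¹ : Matrix (Fin δ) (Fin δ) ℝ) ⊗ₖ (1 : Matrix (Fin n) (Fin n) ℝ)) ?_)
  rw [h', ← Matrix.mul_kronecker_mul, ← hu]
  simp

theorem zero_mem_invertibilitySet {g δ : ℕ} {p : NCMatPoly g δ} (hp0 : IsUnit (constTerm p))
    (n : ℕ) : (0 : SymTuple g n) ∈ invertibilitySet p n :=
  mem_connectedComponentIn (isUnit_ncEval_zero hp0 n)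

theorem isUnit_of_mem_invertibilitySet {g δ n : ℕ} {p : NCMatPoly g δ} {X : SymTuple g n}
    (hX : X ∈ invertibilitySet p n) : IsUnit (ncEval p X) :=
  connectedComponentIn_subset {X : SymTuple g n | IsUnit (ncEval p X)} 0 hX

theorem convex_invertibilitySet {g δ : ℕ} {p : NCMatPoly g δ}
    (hconv : HasConvexInvertibilitySet p) (n : ℕ) : Convex ℝ (invertibilitySet p n) := by
  -- The hypothesis starts at size 1, but the constructions below quantify over all sizes, including
  -- 0.
  rcases Nat.eq_zero_or_pos n with rfl | hn
  · have : Subsingleton (SymTuple g 0) := ⟨fun X Y => by ext j a; exact a.elim0⟩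
    exact Set.subsingleton_of_subsingleton.convex
  · exact hconv n hn

/-- Images of invertibility sets under continuous maps fixing the origin stay in the invertibility
set as long as the polynomial stays invertible. -/
theorem image_subset_invertibilitySet {g δ k : ℕ} {p : NCMatPoly g δ} {α : Type*}
    [TopologicalSpace α] {s : Set α} (hs : IsPreconnected s) {f : α → SymTuple g k}
    (hf : Continuous f) {a : α} (ha : a ∈ s) (hfa : f a = 0)
    (h : ∀ x ∈ s, IsUnit (ncEval p (f x))) : ∀ x ∈ s, f x ∈ invertibilitySet p k := by
  intro x hx
  refine (hs.image f hf.continuousOn).subset_connectedComponentIn ⟨a, ha, hfa⟩ ?_ ⟨x, hx, rfl⟩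
  rintro _ ⟨y, hy, rfl⟩
  exact h y hy

theorem isPreconnected_invertibilitySet {g δ : ℕ} (p : NCMatPoly g δ) (n : ℕ) :
    IsPreconnected (invertibilitySet p n) := isPreconnected_connectedComponentIn

/-! ### Matrix convexity -/

/-- `Z` acts as `X` on the range of `W`, so compressing a left inverse of `p(Z)` by `1 ⊗ W` yields a
left inverse of `p(X)`. -/
theorem isUnit_ncEval_of_isometry {g δ m n : ℕ} {p : NCMatPoly g δ} {Z : SymTuple g m}
    {X : SymTuple g n} {W : Matrix (Fin m) (Fin n) ℝ} (hW : Wᵀ * W = 1)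
    (h : ∀ j, Z.1 j * W = W * X.1 j) (hZ : IsUnit (ncEval p Z)) : IsUnit (ncEval p X) := by
  obtain ⟨B, hB⟩ := hZ.exists_left_inv
  refine IsUnit.of_mul_eq_one_right (((1 : Matrix (Fin δ) (Fin δ) ℝ) ⊗ₖ Wᵀ) *
    B * ((1 : Matrix (Fin δ) (Fin δ) ℝ) ⊗ₖ W)) ?_
  rw [Matrix.mul_assoc, ← ncEval_mul_of_intertwine p h, Matrix.mul_assoc,
    ← Matrix.mul_assoc B, hB, Matrix.one_mul,
    ← Matrix.mul_kronecker_mul, hW]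
  simp

/-- The reflection `U = 2WWᵀ - 1` is orthogonal, so `UYU` lies in the set with `Y`. Averaging the
two removes the off-diagonal blocks relative to the range of `W`, leaving a tuple that intertwines
with `WᵀYW` through `W`. -/
theorem conjTuple_mem_of_isometry {g δ m n : ℕ} {p : NCMatPoly g δ}
    (hp0 : IsUnit (constTerm p)) (hconv : HasConvexInvertibilitySet p)
    {W : Matrix (Fin m) (Fin n) ℝ} (hW : Wᵀ * W = 1) {Y : SymTuple g m}
    (hY : Y ∈ invertibilitySet p m) : conjTuple W Y ∈ invertibilitySet p n := by
  have h0 := zero_mem_invertibilitySet (g := g) hp0 m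
  refine image_subset_invertibilitySet (isPreconnected_invertibilitySet p m)
    (continuous_conjTuple W) h0 (map_zero _) ?_ Y hY
  intro Y hY
  set U : Matrix (Fin m) (Fin m) ℝ := (2 : ℝ) • (W * Wᵀ) - 1 with hU
  have hUW : U * W = W := by
    rw [hU, Matrix.sub_mul, Matrix.smul_mul, Matrix.mul_assoc, hW, Matrix.mul_one, Matrix.one_mul,
      two_smul, add_sub_cancel_right]
  have hUt : Uᵀ = U := by simp [hU, Matrix.transpose_mul]
  have hUU : Uᵀ * U = 1 := by
    rw [hUt]
    nth_rw 2 [hU]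
    rw [Matrix.mul_sub, Matrix.mul_smul, ← Matrix.mul_assoc, hUW, Matrix.mul_one, hU,
      sub_sub_cancel]
  have hUY : conjTuple U Y ∈ invertibilitySet p m := by
    refine image_subset_invertibilitySet (isPreconnected_invertibilitySet p m)
      (continuous_conjTuple U) h0 (map_zero _) (fun Z hZ => ?_) Y hY
    refine isUnit_ncEval_of_isometry hUU (fun j => ?_) (isUnit_of_mem_invertibilitySet hZ)
    rw [conjTuple_apply, ← Matrix.mul_assoc, ← Matrix.mul_assoc]
    rw [hUt] at hUU ⊢
    rw [hUU, Matrix.one_mul]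
  have hmid := (convex_invertibilitySet hconv m) hY hUY (a := 1 / 2) (b := 1 / 2)
    (by norm_num) (by norm_num) (by norm_num)
  refine isUnit_ncEval_of_isometry hW (fun j => ?_) (isUnit_of_mem_invertibilitySet hmid)
  have e1 : U * Y.1 j * U * W = (2 : ℝ) • (W * (Wᵀ * Y.1 j * W)) - Y.1 j * W := by
    rw [Matrix.mul_assoc, hUW, hU]
    simp [Matrix.sub_mul, Matrix.mul_assoc]
  have e2 : ((1 / 2 : ℝ) • Y + (1 / 2 : ℝ) • conjTuple U Y).1 j =
      (1 / 2 : ℝ) • Y.1 j + (1 / 2 : ℝ) • (U * Y.1 j * U) := by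
    change (1 / 2 : ℝ) • Y.1 j + (1 / 2 : ℝ) • (Uᵀ * Y.1 j * U) = _
    rw [hUt]
  rw [e2, Matrix.add_mul, Matrix.smul_mul, Matrix.smul_mul, e1, conjTuple_apply]
  module

theorem directSum_mem {g δ m n k : ℕ} {p : NCMatPoly g δ} (hp0 : IsUnit (constTerm p))
    {E : Matrix (Fin k) (Fin m) ℝ} {F : Matrix (Fin k) (Fin n) ℝ} (hE : Eᵀ * E = 1)
    (hF : Fᵀ * F = 1) (hEF : Eᵀ * F = 0) (hsum : E * Eᵀ + F * Fᵀ = 1)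
    {X : SymTuple g m} {Y : SymTuple g n} (hX : X ∈ invertibilitySet p m)
    (hY : Y ∈ invertibilitySet p n) : conjTuple Eᵀ X + conjTuple Fᵀ Y ∈ invertibilitySet p k := by
  have hFE : Fᵀ * E = 0 := by
    have := congrArg Matrix.transpose hEF
    simpa using this
  refine image_subset_invertibilitySet (f := fun z : SymTuple g m × SymTuple g n =>
    conjTuple Eᵀ z.1 + conjTuple Fᵀ z.2) (s := invertibilitySet p m ×ˢ invertibilitySet p n)
    (a := (0, 0)) ((isPreconnected_invertibilitySet p m).prod (isPreconnected_invertibilitySet p n))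
    (((continuous_conjTuple _).comp continuous_fst).add
      ((continuous_conjTuple _).comp continuous_snd))
    ⟨zero_mem_invertibilitySet hp0 m, zero_mem_invertibilitySet hp0 n⟩ (by simp) ?_ (X, Y) ⟨hX, hY⟩
  rintro ⟨X, Y⟩ ⟨hX, hY⟩
  obtain ⟨A, hA⟩ := (isUnit_of_mem_invertibilitySet hX).exists_right_inv
  obtain ⟨B, hB⟩ := (isUnit_of_mem_invertibilitySet hY).exists_right_inv
  simp only at hA hB ⊢
  have h1 := ncEval_mul_of_intertwine p (Z := conjTuple Eᵀ X + conjTuple Fᵀ Y) (X := X) (E := E)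
    (fun j => by
      change (Eᵀᵀ * X.1 j * Eᵀ + Fᵀᵀ * Y.1 j * Fᵀ) * E = _
      simp [Matrix.add_mul, Matrix.mul_assoc, hE, hFE])
  have h2 := ncEval_mul_of_intertwine p (Z := conjTuple Eᵀ X + conjTuple Fᵀ Y) (X := Y) (E := F)
    (fun j => by
      change (Eᵀᵀ * X.1 j * Eᵀ + Fᵀᵀ * Y.1 j * Fᵀ) * F = _
      simp [Matrix.add_mul, Matrix.mul_assoc, hF, hEF])
  refine IsUnit.of_mul_eq_one
    (((1 : Matrix (Fin δ) (Fin δ) ℝ) ⊗ₖ E) * A *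
        ((1 : Matrix (Fin δ) (Fin δ) ℝ) ⊗ₖ Eᵀ) +
      ((1 : Matrix (Fin δ) (Fin δ) ℝ) ⊗ₖ F) * B *
        ((1 : Matrix (Fin δ) (Fin δ) ℝ) ⊗ₖ Fᵀ)) ?_
  rw [Matrix.mul_add, ← Matrix.mul_assoc, ← Matrix.mul_assoc, ← Matrix.mul_assoc,
    ← Matrix.mul_assoc, h1, h2, Matrix.mul_assoc _ _ A, Matrix.mul_assoc _ _ B, hA, hB, Matrix.mul_one,
    Matrix.mul_one, ← Matrix.mul_kronecker_mul, ← Matrix.mul_kronecker_mul, Matrix.one_mul,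
    ← Matrix.kronecker_add, hsum]
  simp

/-- The two coordinate embeddings of a direct sum. -/
def inclLeft (m n : ℕ) : Matrix (Fin (m + n)) (Fin m) ℝ :=
  (1 : Matrix (Fin (m + n)) (Fin (m + n)) ℝ).submatrix id (Fin.castAdd n)

def inclRight (m n : ℕ) : Matrix (Fin (m + n)) (Fin n) ℝ :=
  (1 : Matrix (Fin (m + n)) (Fin (m + n)) ℝ).submatrix id (Fin.natAdd m)

theorem inclLeft_transpose_mul_self (m n : ℕ) : (inclLeft m n)ᵀ * inclLeft m n = 1 := by
  ext a b
  simp [inclLeft, Matrix.mul_apply, Matrix.one_apply]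

theorem inclRight_transpose_mul_self (m n : ℕ) : (inclRight m n)ᵀ * inclRight m n = 1 := by
  ext a b
  simp [inclRight, Matrix.mul_apply, Matrix.one_apply]

theorem inclLeft_transpose_mul_inclRight (m n : ℕ) : (inclLeft m n)ᵀ * inclRight m n = 0 := by
  ext a b
  have : Fin.castAdd n a ≠ Fin.natAdd m b := fun h => by
    have := congrArg Fin.val h
    simp at this
    omega
  simp [inclLeft, inclRight, Matrix.mul_apply, Matrix.one_apply, this]

theorem incl_mul_transpose_add (m n : ℕ) :
    inclLeft m n * (inclLeft m n)ᵀ + inclRight m n * (inclRight m n)ᵀ = 1 := by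
  ext a b
  have := congrFun (congrFun
    (Matrix.mul_one (1 : Matrix (Fin (m + n)) (Fin (m + n)) ℝ)) a) b
  rw [Matrix.mul_apply, Fin.sum_univ_add] at this
  simpa [inclLeft, inclRight, Matrix.mul_apply, Matrix.one_apply, eq_comm] using this

/-- `EV + FW` is an isometry, and it compresses the direct sum of `X` and `Y` to `VᵀXV + WᵀYW`. -/
theorem cstarConvex_mem {g δ m n k : ℕ} {p : NCMatPoly g δ} (hp0 : IsUnit (constTerm p))
    (hconv : HasConvexInvertibilitySet p) {V : Matrix (Fin m) (Fin k) ℝ}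
    {W : Matrix (Fin n) (Fin k) ℝ} (hVW : Vᵀ * V + Wᵀ * W = 1) {X : SymTuple g m}
    {Y : SymTuple g n} (hX : X ∈ invertibilitySet p m) (hY : Y ∈ invertibilitySet p n) :
    conjTuple V X + conjTuple W Y ∈ invertibilitySet p k := by
  have hE := inclLeft_transpose_mul_self m n
  have hF := inclRight_transpose_mul_self m n
  have hEF := inclLeft_transpose_mul_inclRight m n
  have hFE : (inclRight m n)ᵀ * inclLeft m n = 0 := by
    have := congrArg Matrix.transpose hEF
    simpa using this
  have h := directSum_mem hp0 hE hF hEF (incl_mul_transpose_add m n) hX hY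
  set E := inclLeft m n
  set F := inclRight m n
  have a1 : Eᵀ * (E * V + F * W) = V := by
    rw [Matrix.mul_add, ← Matrix.mul_assoc, ← Matrix.mul_assoc, hE, hEF]; simp
  have a2 : Fᵀ * (E * V + F * W) = W := by
    rw [Matrix.mul_add, ← Matrix.mul_assoc, ← Matrix.mul_assoc, hF, hFE]; simp
  have b1 : (E * V + F * W)ᵀ * E = Vᵀ := by
    have := congrArg Matrix.transpose a1
    rwa [Matrix.transpose_mul, Matrix.transpose_transpose] at this
  have b2 : (E * V + F * W)ᵀ * F = Wᵀ := by
    have := congrArg Matrix.transpose a2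
    rwa [Matrix.transpose_mul, Matrix.transpose_transpose] at this
  have := conjTuple_mem_of_isometry hp0 hconv (W := E * V + F * W) (by
    rw [Matrix.mul_add, ← Matrix.mul_assoc, ← Matrix.mul_assoc, b1, b2, hVW]) h
  convert this using 1
  apply Subtype.ext
  funext j
  change Vᵀ * X.1 j * V + Wᵀ * Y.1 j * W =
    (E * V + F * W)ᵀ * (Eᵀᵀ * X.1 j * Eᵀ + Fᵀᵀ * Y.1 j * Fᵀ) * (E * V + F * W)
  rw [Matrix.mul_add _ (Eᵀᵀ * X.1 j * Eᵀ), Matrix.add_mul _ _ (E * V + F * W),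
    Matrix.transpose_transpose, Matrix.transpose_transpose, ← Matrix.mul_assoc, ← Matrix.mul_assoc, ← Matrix.mul_assoc, ← Matrix.mul_assoc, b1, b2,
    Matrix.mul_assoc _ Eᵀ, Matrix.mul_assoc _ Fᵀ, a1, a2]

theorem cstarConvex_mem_closure {g δ m n k : ℕ} {p : NCMatPoly g δ} (hp0 : IsUnit (constTerm p))
    (hconv : HasConvexInvertibilitySet p) {V : Matrix (Fin m) (Fin k) ℝ}
    {W : Matrix (Fin n) (Fin k) ℝ} (hVW : Vᵀ * V + Wᵀ * W = 1) {X : SymTuple g m}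
    {Y : SymTuple g n} (hX : X ∈ closure (invertibilitySet p m))
    (hY : Y ∈ closure (invertibilitySet p n)) :
    conjTuple V X + conjTuple W Y ∈ closure (invertibilitySet p k) := by
  refine map_mem_closure₂ (f := fun X Y => conjTuple V X + conjTuple W Y) ?_ hX hY
    fun a ha b hb => cstarConvex_mem hp0 hconv hVW ha hb
  exact ((continuous_conjTuple _).comp continuous_fst).add
    ((continuous_conjTuple _).comp continuous_snd)

open scoped MatrixOrder in
theorem exists_eq_transpose_mul_self {k : ℕ} {G : Matrix (Fin k) (Fin k) ℝ} (hG : G.PosSemidef) :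
    ∃ B : Matrix (Fin k) (Fin k) ℝ, G = Bᵀ * B := by
  obtain ⟨B, hB⟩ := CStarAlgebra.nonneg_iff_eq_star_mul_self.mp hG.nonneg
  exact ⟨B, by rw [hB, Matrix.star_eq_conjTranspose, Matrix.conjTranspose_eq_transpose_of_trivial]⟩

/-- Contractive compressions preserve the closure of the invertibility set. -/
theorem conjTuple_mem_closure {g δ m k : ℕ} {p : NCMatPoly g δ} (hp0 : IsUnit (constTerm p))
    (hconv : HasConvexInvertibilitySet p) {V : Matrix (Fin m) (Fin k) ℝ}
    (hV : (1 - Vᵀ * V).PosSemidef) {X : SymTuple g m}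
    (hX : X ∈ closure (invertibilitySet p m)) :
    conjTuple V X ∈ closure (invertibilitySet p k) := by
  -- `BᵀB` fills the defect `1 - VᵀV`; pairing `B` with the zero tuple adds nothing to the
  -- compression.
  obtain ⟨B, hB⟩ := exists_eq_transpose_mul_self hV
  have := cstarConvex_mem_closure hp0 hconv (V := V) (W := B) (by rw [← hB]; abel) hX
    (subset_closure (zero_mem_invertibilitySet hp0 k))
  simpa using this

/-! ### Trace duality and Effros–Winkler separation -/

theorem exists_trace_eq {n : ℕ} (f : Matrix (Fin n) (Fin n) ℝ →ₗ[ℝ] ℝ) :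
    ∃ T : Matrix (Fin n) (Fin n) ℝ, ∀ G, f G = (T * G).trace := by
  refine ⟨Matrix.of fun a b => f (Matrix.single b a 1), fun G => ?_⟩
  conv_lhs => rw [Matrix.matrix_eq_sum_single G]
  simp only [map_sum, Matrix.trace, Matrix.diag, Matrix.mul_apply, Matrix.of_apply]
  rw [Finset.sum_comm]
  refine Finset.sum_congr rfl fun a _ => Finset.sum_congr rfl fun b _ => ?_
  rw [show Matrix.single b a (G b a) = G b a • Matrix.single b a (1 : ℝ) by simp, map_smul,
    smul_eq_mul, mul_comm]

theorem trace_symmetrize {n : ℕ} (T : Matrix (Fin n) (Fin n) ℝ) {G : Matrix (Fin n) (Fin n) ℝ}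
    (hG : Gᵀ = G) : (((1 / 2 : ℝ) • (T + Tᵀ)) * G).trace = (T * G).trace := by
  have : (Tᵀ * G).trace = (T * G).trace := by
    rw [← Matrix.trace_transpose, Matrix.transpose_mul, Matrix.transpose_transpose, hG,
      Matrix.trace_mul_comm]
  rw [Matrix.smul_mul, Matrix.add_mul, Matrix.trace_smul, Matrix.trace_add, this, smul_eq_mul]
  ring

/-- The symmetric part, as a linear map from tuples of matrices. -/
noncomputable def symPart (g n : ℕ) : (Fin g → Matrix (Fin n) (Fin n) ℝ) →ₗ[ℝ] SymTuple g n where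
  toFun Z := ⟨fun j => (1 / 2 : ℝ) • (Z j + (Z j)ᵀ), fun j => by
    simp [Matrix.IsSymm, add_comm]⟩
  map_add' X Y := by
    apply Subtype.ext
    funext j
    change (1 / 2 : ℝ) • ((X j + Y j) + (X j + Y j)ᵀ) =
      (1 / 2 : ℝ) • (X j + (X j)ᵀ) + (1 / 2 : ℝ) • (Y j + (Y j)ᵀ)
    rw [Matrix.transpose_add]
    module
  map_smul' c X := by
    apply Subtype.ext
    funext j
    change (1 / 2 : ℝ) • (c • X j + (c • X j)ᵀ) = c • ((1 / 2 : ℝ) • (X j + (X j)ᵀ))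
    rw [Matrix.transpose_smul]
    module

theorem symPart_coe {g n : ℕ} (X : SymTuple g n) : symPart g n X.1 = X := by
  apply Subtype.ext
  funext j
  have h : (X.1 j)ᵀ = X.1 j := X.2 j
  change (1 / 2 : ℝ) • (X.1 j + (X.1 j)ᵀ) = X.1 j
  rw [h]
  module

theorem exists_sum_trace_eq {g n : ℕ} (f : SymTuple g n →ₗ[ℝ] ℝ) :
    ∃ Λ : Fin g → Matrix (Fin n) (Fin n) ℝ, (∀ j, (Λ j)ᵀ = Λ j) ∧
      ∀ Y : SymTuple g n, f Y = ∑ j, (Λ j * Y.1 j).trace := by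
  choose T hT using fun j => exists_trace_eq
    ((f ∘ₗ symPart g n) ∘ₗ LinearMap.single ℝ (fun _ : Fin g => Matrix (Fin n) (Fin n) ℝ) j)
  refine ⟨fun j => (1 / 2 : ℝ) • (T j + (T j)ᵀ), fun j => by simp [add_comm], fun Y => ?_⟩
  have h : ∀ j, (Y.1 j)ᵀ = Y.1 j := Y.2
  simp only [fun j => trace_symmetrize (T j) (h j), ← hT]
  simp only [LinearMap.comp_apply, LinearMap.single_apply]
  rw [← map_sum f, ← map_sum (symPart g n), Finset.univ_sum_single, symPart_coe]

theorem exists_separating_functional {g δ n : ℕ} {p : NCMatPoly g δ} (hp0 : IsUnit (constTerm p))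
    (hconv : HasConvexInvertibilitySet p) {Z : SymTuple g n} (hZ : Z ∉ invertibilitySet p n) :
    ∃ f : SymTuple g n →ₗ[ℝ] ℝ, f Z = 1 ∧ ∀ Y ∈ closure (invertibilitySet p n), f Y ≤ 1 := by
  obtain ⟨f, hf⟩ := geometric_hahn_banach_open_point (convex_invertibilitySet hconv n)
    (isOpen_invertibilitySet p n) hZ
  have hpos : 0 < f Z := by simpa using hf 0 (zero_mem_invertibilitySet hp0 n)
  refine ⟨(f Z)⁻¹ • f.toLinearMap, by simp [hpos.ne'], fun Y hY => ?_⟩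
  have : f Y ≤ f Z := by
    have hc : IsClosed {Y | f Y ≤ f Z} := isClosed_le f.continuous continuous_const
    exact closure_minimal (fun Y hY => (hf Y hY).le) hc hY
  simp only [LinearMap.smul_apply, ContinuousLinearMap.coe_coe, smul_eq_mul]
  rw [inv_mul_le_one₀ hpos]
  exact this

/-- With no normalisation of `VᵀV + WᵀW`, this is what makes the cone of pairs `(VᵀV, f(VᵀYV))`
closed under addition. -/
theorem exists_directSum {g δ m n k : ℕ} {p : NCMatPoly g δ} (hp0 : IsUnit (constTerm p))
    (hconv : HasConvexInvertibilitySet p) (V : Matrix (Fin m) (Fin k) ℝ)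
    (W : Matrix (Fin n) (Fin k) ℝ) {X : SymTuple g m} {Y : SymTuple g n}
    (hX : X ∈ closure (invertibilitySet p m)) (hY : Y ∈ closure (invertibilitySet p n)) :
    ∃ (Z : SymTuple g (m + n)) (U : Matrix (Fin (m + n)) (Fin k) ℝ),
      Z ∈ closure (invertibilitySet p (m + n)) ∧ Uᵀ * U = Vᵀ * V + Wᵀ * W ∧
      conjTuple U Z = conjTuple V X + conjTuple W Y := by
  have hE := inclLeft_transpose_mul_self m n
  have hF := inclRight_transpose_mul_self m n
  have hEF := inclLeft_transpose_mul_inclRight m n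
  have hFE : (inclRight m n)ᵀ * inclLeft m n = 0 := by
    have := congrArg Matrix.transpose hEF
    simpa using this
  set E := inclLeft m n
  set F := inclRight m n
  have a1 : Eᵀ * (E * V + F * W) = V := by
    rw [Matrix.mul_add, ← Matrix.mul_assoc, ← Matrix.mul_assoc, hE, hEF]; simp
  have a2 : Fᵀ * (E * V + F * W) = W := by
    rw [Matrix.mul_add, ← Matrix.mul_assoc, ← Matrix.mul_assoc, hF, hFE]; simp
  have b1 : (E * V + F * W)ᵀ * E = Vᵀ := by
    have := congrArg Matrix.transpose a1
    rwa [Matrix.transpose_mul, Matrix.transpose_transpose] at this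
  have b2 : (E * V + F * W)ᵀ * F = Wᵀ := by
    have := congrArg Matrix.transpose a2
    rwa [Matrix.transpose_mul, Matrix.transpose_transpose] at this
  refine ⟨conjTuple Eᵀ X + conjTuple Fᵀ Y, E * V + F * W,
    cstarConvex_mem_closure hp0 hconv ?_ hX hY, ?_, ?_⟩
  · simpa using incl_mul_transpose_add m n
  · rw [Matrix.mul_add, ← Matrix.mul_assoc, ← Matrix.mul_assoc, b1, b2]
  · apply Subtype.ext
    funext j
    change (E * V + F * W)ᵀ * (Eᵀᵀ * X.1 j * Eᵀ + Fᵀᵀ * Y.1 j * Fᵀ) * (E * V + F * W) =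
      Vᵀ * X.1 j * V + Wᵀ * Y.1 j * W
    rw [Matrix.mul_add _ (Eᵀᵀ * X.1 j * Eᵀ), Matrix.add_mul _ _ (E * V + F * W),
      Matrix.transpose_transpose, Matrix.transpose_transpose, ← Matrix.mul_assoc,
      ← Matrix.mul_assoc, ← Matrix.mul_assoc, ← Matrix.mul_assoc, b1, b2,
      Matrix.mul_assoc _ Eᵀ, Matrix.mul_assoc _ Fᵀ, a1, a2]

theorem conjTuple_smul {g m n : ℕ} (c : ℝ) (V : Matrix (Fin m) (Fin n) ℝ) (X : SymTuple g m) :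
    conjTuple (c • V) X = (c * c) • conjTuple V X := by
  apply Subtype.ext
  funext j
  change (c • V)ᵀ * X.1 j * (c • V) = (c * c) • (Vᵀ * X.1 j * V)
  simp [smul_smul]

open scoped Matrix.Norms.L2Operator in
theorem posSemidef_one_sub {n : ℕ} {G : Matrix (Fin n) (Fin n) ℝ} (hG : Gᵀ = G)
    (hnorm : ‖G‖ ≤ 1) : (1 - G).PosSemidef := by
  refine Matrix.PosSemidef.of_dotProduct_mulVec_nonneg ?_ fun x => ?_
  · rw [Matrix.IsHermitian, Matrix.conjTranspose_eq_transpose_of_trivial, Matrix.transpose_sub, hG,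
      Matrix.transpose_one]
  · have h1 := Matrix.l2_opNorm_mulVec G (WithLp.toLp 2 x)
    have h2 := real_inner_le_norm (WithLp.toLp 2 x) (WithLp.toLp 2 (G *ᵥ x))
    have h3 : inner ℝ (WithLp.toLp 2 x) (WithLp.toLp 2 (G *ᵥ x)) = x ⬝ᵥ G *ᵥ x := by
      simp [PiLp.inner_apply, dotProduct, mul_comm]
    have h4 : ‖WithLp.toLp 2 x‖ * ‖WithLp.toLp 2 x‖ = x ⬝ᵥ x := by
      rw [← sq, EuclideanSpace.real_norm_sq_eq]
      simp [dotProduct, sq]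
    have h5 : ‖WithLp.toLp 2 (G *ᵥ x)‖ ≤ ‖WithLp.toLp 2 x‖ :=
      h1.trans (mul_le_of_le_one_left (norm_nonneg _) hnorm)
    rw [Matrix.sub_mulVec, Matrix.one_mulVec, star_trivial, dotProduct_sub]
    nlinarith [norm_nonneg (WithLp.toLp 2 x : EuclideanSpace ℝ (Fin n))]

open scoped Matrix.Norms.L2Operator in
/-- The Effros–Winkler dominating form of a functional bounded by one on the closure of the
invertibility set. -/
theorem exists_dominating_form {g δ n : ℕ} {p : NCMatPoly g δ} (hp0 : IsUnit (constTerm p))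
    (hconv : HasConvexInvertibilitySet p) {f : SymTuple g n →ₗ[ℝ] ℝ}
    (hf : ∀ Y ∈ closure (invertibilitySet p n), f Y ≤ 1) :
    ∃ T : Matrix (Fin n) (Fin n) ℝ, Tᵀ = T ∧ T.trace ≤ 1 ∧
      ∀ (m : ℕ) (Y : SymTuple g m), Y ∈ closure (invertibilitySet p m) →
        ∀ V : Matrix (Fin m) (Fin n) ℝ, f (conjTuple V Y) ≤ (T * (Vᵀ * V)).trace := by
  -- Hahn–Banach separates the open convex cone `s` from the convex cone `t`; the separating
  -- functional, scaled, is `(G, c) ↦ tr(TG) - c`.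
  set s : Set (Matrix (Fin n) (Fin n) ℝ × ℝ) := {a | ‖a.1‖ < a.2}
  set t : Set (Matrix (Fin n) (Fin n) ℝ × ℝ) := {a | ∃ (m : ℕ) (Y : SymTuple g m)
    (V : Matrix (Fin m) (Fin n) ℝ), Y ∈ closure (invertibilitySet p m) ∧
      a = (Vᵀ * V, f (conjTuple V Y))}
  have hs : IsOpen s := isOpen_lt (continuous_norm.comp continuous_fst) continuous_snd
  have hsc : Convex ℝ s := by
    intro a ha b hb α β hα hβ hαβ
    have ha : ‖a.1‖ < a.2 := ha
    have hb : ‖b.1‖ < b.2 := hb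
    change ‖α • a.1 + β • b.1‖ < α * a.2 + β * b.2
    have h1 := norm_add_le (α • a.1) (β • b.1)
    rw [norm_smul, norm_smul, Real.norm_of_nonneg hα, Real.norm_of_nonneg hβ] at h1
    rcases hα.eq_or_lt with rfl | hα'
    · obtain rfl : β = 1 := by linarith
      linarith
    · nlinarith [mul_lt_mul_of_pos_left ha hα', mul_le_mul_of_nonneg_left hb.le hβ]
  have hsmul : ∀ a ∈ t, ∀ r : ℝ, 0 ≤ r → r • a ∈ t := by
    rintro _ ⟨m, Y, V, hY, rfl⟩ r hr
    refine ⟨m, Y, √r • V, hY, ?_⟩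
    rw [conjTuple_smul, Real.mul_self_sqrt hr, map_smul, Matrix.transpose_smul, Matrix.smul_mul,
      Matrix.mul_smul, smul_smul, Real.mul_self_sqrt hr]
    rfl
  have hadd : ∀ a ∈ t, ∀ b ∈ t, a + b ∈ t := by
    rintro _ ⟨m, Y, V, hY, rfl⟩ _ ⟨m', Y', V', hY', rfl⟩
    obtain ⟨Z, U, hZ, hU, hUZ⟩ := exists_directSum hp0 hconv V V' hY hY'
    refine ⟨m + m', Z, U, hZ, ?_⟩
    rw [hU, hUZ, map_add]
    rfl
  have htc : Convex ℝ t := fun a ha b hb α β hα hβ _ =>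
    hadd _ (hsmul a ha α hα) _ (hsmul b hb β hβ)
  have hdisj : Disjoint s t := by
    rw [Set.disjoint_left]
    rintro _ ha ⟨m, Y, V, hY, rfl⟩
    have ha : ‖Vᵀ * V‖ < f (conjTuple V Y) := ha
    -- Dividing `V` by `√c` makes it a contraction, so the compression stays in the closure and `f`
    -- of it is at most 1, against `c < f(VᵀYV)`.
    obtain ⟨c, hc1, hc2⟩ := exists_between ha
    have hc : 0 < c := (norm_nonneg _).trans_lt hc1
    have hr : 0 ≤ c⁻¹ := by positivity
    have hmem := conjTuple_mem_closure hp0 hconv (V := √c⁻¹ • V) (X := Y) (by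
      apply posSemidef_one_sub
      · simp [Matrix.transpose_mul]
      · rw [Matrix.transpose_smul, Matrix.smul_mul, Matrix.mul_smul, smul_smul,
          Real.mul_self_sqrt hr, norm_smul, Real.norm_of_nonneg hr, inv_mul_le_one₀ hc]
        exact hc1.le) hY
    have := hf _ hmem
    rw [conjTuple_smul, Real.mul_self_sqrt hr, map_smul, smul_eq_mul, inv_mul_le_one₀ hc] at this
    linarith
  obtain ⟨φ, u, hφs, hφt⟩ := geometric_hahn_banach_open hsc hs htc hdisj
  have h0t : (0 : Matrix (Fin n) (Fin n) ℝ × ℝ) ∈ t :=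
    ⟨0, 0, 0, subset_closure (zero_mem_invertibilitySet hp0 0), by simp; rfl⟩
  have hu : u ≤ 0 := by simpa using hφt 0 h0t
  -- A functional bounded below on a cone is nonnegative there: otherwise a multiple of `a` reaches
  -- the value `u - 1`.
  have hφt' : ∀ a ∈ t, 0 ≤ φ a := by
    intro a ha
    by_contra! hneg
    have := hφt _ (hsmul a ha ((u - 1) / φ a) (div_nonneg_of_nonpos (by linarith) hneg.le))
    rw [map_smul, smul_eq_mul, div_mul_cancel₀ _ hneg.ne] at this
    linarith
  set r : ℝ := -φ (0, 1) with hr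
  have hrpos : 0 < r := by
    have := hφs (0, 1) (by change ‖(0 : Matrix (Fin n) (Fin n) ℝ)‖ < 1; simp)
    linarith
  have hsplit : ∀ a : Matrix (Fin n) (Fin n) ℝ × ℝ, φ a = φ (a.1, 0) - r * a.2 := by
    intro a
    have : a = (a.1, 0) + a.2 • ((0, 1) : Matrix (Fin n) (Fin n) ℝ × ℝ) := by
      ext <;> simp
    conv_lhs => rw [this]
    rw [map_add, map_smul, smul_eq_mul, hr]
    ring
  obtain ⟨T, hT⟩ := exists_trace_eq (r⁻¹ • φ.toLinearMap ∘ₗ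
    LinearMap.inl ℝ (Matrix (Fin n) (Fin n) ℝ) ℝ)
  have hT' : ∀ G, φ (G, 0) = r * (T * G).trace := by
    intro G
    rw [← hT]
    simp [hrpos.ne']
  refine ⟨(1 / 2 : ℝ) • (T + Tᵀ), by simp [add_comm], ?_, fun m Y hY V => ?_⟩
  · have e := trace_symmetrize T (G := 1) (by simp)
    rw [Matrix.mul_one, Matrix.mul_one] at e
    rw [e]
    refine le_of_forall_pos_le_add fun ε hε => ?_
    have hone : ‖(1 : Matrix (Fin n) (Fin n) ℝ)‖ ≤ 1 := by
      rcases isEmpty_or_nonempty (Fin n) with h | h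
      · rw [Subsingleton.elim (1 : Matrix (Fin n) (Fin n) ℝ) 0]; simp
      · exact norm_one.le
    -- The points `(1, 1 + ε)` of `s` give `tr T < 1 + ε`.
    have := hφs (1, 1 + ε) (by change ‖(1 : Matrix (Fin n) (Fin n) ℝ)‖ < 1 + ε; linarith)
    rw [hsplit, hT', Matrix.mul_one] at this
    simp only at this
    nlinarith
  · rw [trace_symmetrize T (by simp [Matrix.transpose_mul])]
    have := hφt' _ ⟨m, Y, V, hY, rfl⟩
    rw [hsplit, hT'] at this
    simp only at this
    nlinarith

/-! ### First variation at a boundary point -/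

theorem eq_zero_of_quadratic_nonneg {a b : ℝ} (ha : 0 ≤ a)
    (h : ∀ t : ℝ, 0 < t → 0 ≤ -(2 * t * a) + t ^ 2 * b) : a = 0 := by
  by_contra hne
  have hpos : 0 < a := lt_of_le_of_ne ha (Ne.symm hne)
  have h1 := h (a / (|b| + 1)) (by positivity)
  have hb : b ≤ |b| := le_abs_self b
  have hb0 := abs_nonneg b
  set t := a / (|b| + 1) with ht
  have ht0 : 0 < t := by positivity
  have hta : t * (|b| + 1) = a := by rw [ht]; field_simp
  nlinarith [mul_pos ht0 hpos]

/-- A form nonnegative on the closure of the invertibility set which vanishes at the identity. -/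
theorem eq_sum_mul_of_form_nonneg {g n : ℕ} {T : Matrix (Fin n) (Fin n) ℝ}
    {Λ X : Fin g → Matrix (Fin n) (Fin n) ℝ} (hT : Tᵀ = T) (hΛ : ∀ j, (Λ j)ᵀ = Λ j)
    (hX : ∀ j, (X j)ᵀ = X j)
    (hform : ∀ V : Matrix (Fin n) (Fin n) ℝ,
      ∑ j, (Λ j * (Vᵀ * X j * V)).trace ≤ (T * (Vᵀ * V)).trace)
    (hone : T.trace ≤ ∑ j, (Λ j * X j).trace) : T = ∑ j, X j * Λ j := by
  set K := T - ∑ j, X j * Λ j with hK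
  have hKt : (Kᵀ * K).trace = 0 := by
    refine eq_zero_of_quadratic_nonneg (b := (T * (Kᵀ * K)).trace -
      ∑ j, (Λ j * (Kᵀ * X j * K)).trace) ?_ fun t ht => ?_
    · simpa using (Matrix.posSemidef_conjTranspose_mul_self K).trace_nonneg
    · have h := hform (1 - t • K)
      have e1 : (T * ((1 - t • K)ᵀ * (1 - t • K))).trace =
          T.trace - 2 * t * (Kᵀ * T).trace + t ^ 2 * (T * (Kᵀ * K)).trace := by
        have : (T * K).trace = (Kᵀ * T).trace := by
          rw [← Matrix.trace_transpose, Matrix.transpose_mul, hT]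
        have h2 : (T * Kᵀ).trace = (Kᵀ * T).trace := Matrix.trace_mul_comm _ _
        simp only [Matrix.transpose_sub, Matrix.transpose_one, Matrix.transpose_smul,
          Matrix.mul_sub, Matrix.sub_mul, Matrix.one_mul, Matrix.mul_one, Matrix.smul_mul,
          Matrix.mul_smul, Matrix.trace_sub, Matrix.trace_smul, smul_eq_mul, this, h2]
        ring
      have e2 : ∀ j, (Λ j * ((1 - t • K)ᵀ * X j * (1 - t • K))).trace =
          (Λ j * X j).trace - 2 * t * (Kᵀ * (X j * Λ j)).trace +
            t ^ 2 * (Λ j * (Kᵀ * X j * K)).trace := by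
        intro j
        have h1 : (Λ j * (X j * K)).trace = (Kᵀ * (X j * Λ j)).trace := by
          rw [← Matrix.trace_transpose, Matrix.transpose_mul, Matrix.transpose_mul, hX, hΛ,
            Matrix.mul_assoc]
        have h2 : (Λ j * (Kᵀ * X j)).trace = (Kᵀ * (X j * Λ j)).trace := by
          rw [Matrix.trace_mul_comm, Matrix.mul_assoc]
        simp only [Matrix.transpose_sub, Matrix.transpose_one, Matrix.transpose_smul,
          Matrix.mul_sub, Matrix.sub_mul, Matrix.one_mul, Matrix.mul_one, Matrix.smul_mul,
          Matrix.mul_smul, Matrix.trace_sub, Matrix.trace_smul, smul_eq_mul, h1, h2]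
        ring
      have e3 : (Kᵀ * K).trace = (Kᵀ * T).trace - ∑ j, (Kᵀ * (X j * Λ j)).trace := by
        conv_lhs => rw [hK]
        rw [Matrix.mul_sub, Matrix.trace_sub, Matrix.mul_sum, Matrix.trace_sum]
      simp only [e1, e2, Finset.sum_add_distrib, Finset.sum_sub_distrib, ← Finset.mul_sum] at h
      rw [e3]
      linarith
  have : K = 0 := by
    have := (Matrix.trace_conjTranspose_mul_self_eq_zero_iff (A := K)).1 (by simpa using hKt)
    exact this
  exact sub_eq_zero.1 this

/-- Testing the dominating form on `VP` replaces `T` and `Λ_j` by their compressions by `P`. The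
functional that equals 1 at `PXP` then gives a form vanishing at `V = 1`, `Y = X`, although `X`
itself was not separated. -/
theorem exists_separating_form {g δ n : ℕ} {p : NCMatPoly g δ} (hp0 : IsUnit (constTerm p))
    (hconv : HasConvexInvertibilitySet p) {X : SymTuple g n}
    (hX : X ∈ closure (invertibilitySet p n)) {P : Matrix (Fin n) (Fin n) ℝ} (hP : Pᵀ = P)
    (hPP : P * P = P) (hPX : conjTuple P X ∉ invertibilitySet p n) :
    ∃ (T : Matrix (Fin n) (Fin n) ℝ) (Λ : Fin g → Matrix (Fin n) (Fin n) ℝ),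
      Tᵀ = T ∧ (∀ j, (Λ j)ᵀ = Λ j) ∧ P * T = T ∧ (∀ j, P * Λ j = Λ j) ∧ T ≠ 0 ∧
      T = ∑ j, X.1 j * Λ j ∧
      ∀ (m : ℕ) (Y : SymTuple g m), Y ∈ closure (invertibilitySet p m) →
        ∀ V : Matrix (Fin m) (Fin n) ℝ,
          ∑ j, (Λ j * (Vᵀ * Y.1 j * V)).trace ≤ (T * (Vᵀ * V)).trace := by
  obtain ⟨f, hfX, hf⟩ := exists_separating_functional hp0 hconv hPX
  obtain ⟨T, hT, htr, hdom⟩ := exists_dominating_form hp0 hconv hf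
  obtain ⟨Λ, hΛ, hfΛ⟩ := exists_sum_trace_eq f
  have hform : ∀ (m : ℕ) (Y : SymTuple g m), Y ∈ closure (invertibilitySet p m) →
      ∀ V : Matrix (Fin m) (Fin n) ℝ, ∑ j, ((P * Λ j * P) * (Vᵀ * Y.1 j * V)).trace ≤
        ((P * T * P) * (Vᵀ * V)).trace := by
    intro m Y hY V
    have h := hdom m Y hY (V * P)
    rw [hfΛ] at h
    have e1 : (T * ((V * P)ᵀ * (V * P))).trace = ((P * T * P) * (Vᵀ * V)).trace := by
      rw [Matrix.transpose_mul, hP, Matrix.mul_assoc P T, Matrix.mul_assoc P (T * P),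
        Matrix.trace_mul_comm P]
      simp only [Matrix.mul_assoc]
    have e2 : ∀ j, (Λ j * ((V * P)ᵀ * Y.1 j * (V * P))).trace =
        ((P * Λ j * P) * (Vᵀ * Y.1 j * V)).trace := by
      intro j
      rw [Matrix.transpose_mul, hP, Matrix.mul_assoc P (Λ j), Matrix.mul_assoc P (Λ j * P),
        Matrix.trace_mul_comm P]
      simp only [Matrix.mul_assoc]
    simp only [conjTuple_apply, e1, e2] at h
    exact h
  have hval : ∑ j, ((P * Λ j * P) * X.1 j).trace = 1 := by
    rw [← hfX, hfΛ]
    refine Finset.sum_congr rfl fun j _ => ?_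
    rw [conjTuple_apply, hP, Matrix.mul_assoc P (Λ j), Matrix.mul_assoc P, Matrix.trace_mul_comm P]
    simp only [Matrix.mul_assoc]
  have htrP : (P * T * P).trace ≤ 1 := by
    -- At the zero tuple with `V = 1 - P` the form gives `0 ≤ tr(T(1 - P))`, so compressing by `P`
    -- does not increase the trace.
    have h := hdom n 0 (subset_closure (zero_mem_invertibilitySet hp0 n)) (1 - P)
    have e : (1 - P)ᵀ * (1 - P) = 1 - P := by
      simp [Matrix.transpose_sub, hP, Matrix.mul_sub, Matrix.sub_mul, hPP]
    rw [map_zero, map_zero, e, Matrix.mul_sub, Matrix.mul_one, Matrix.trace_sub] at h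
    rw [Matrix.trace_mul_comm, ← Matrix.mul_assoc, hPP, Matrix.trace_mul_comm]
    linarith
  have hT' : (P * T * P)ᵀ = P * T * P := by
    simp only [Matrix.transpose_mul, hP, hT, Matrix.mul_assoc]
  have hΛ' : ∀ j, (P * Λ j * P)ᵀ = P * Λ j * P := by
    intro j
    simp only [Matrix.transpose_mul, hP, hΛ, Matrix.mul_assoc]
  refine ⟨P * T * P, fun j => P * Λ j * P, hT', hΛ', ?_, fun j => ?_, ?_, ?_, hform⟩
  · rw [← Matrix.mul_assoc, ← Matrix.mul_assoc, hPP]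
  · rw [← Matrix.mul_assoc, ← Matrix.mul_assoc, hPP]
  · intro h0
    have h := hform n X hX 1
    simp only [Matrix.transpose_one, Matrix.one_mul, Matrix.mul_one, h0, hval,
      Matrix.trace_zero] at h
    linarith
  · exact eq_sum_mul_of_form_nonneg hT' hΛ' X.2 (hform n X hX) (by rw [hval]; exact htrP)

/-! ### Normalising a form to a monic pencil -/

theorem posSemidef_transpose_mul_self {m n : ℕ} (V : Matrix (Fin m) (Fin n) ℝ) :
    (Vᵀ * V).PosSemidef := by
  rw [← Matrix.conjTranspose_eq_transpose_of_trivial]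
  exact Matrix.posSemidef_conjTranspose_mul_self V

theorem exists_projection {n : ℕ} (M : Submodule ℝ (Fin n → ℝ)) :
    ∃ P : Matrix (Fin n) (Fin n) ℝ, Pᵀ = P ∧ P * P = P ∧ (∀ x, P *ᵥ x ∈ M) ∧
      ∀ x ∈ M, P *ᵥ x = x := by
  set N : Submodule ℝ (EuclideanSpace ℝ (Fin n)) :=
    M.comap (WithLp.linearEquiv 2 ℝ (Fin n → ℝ)).toLinearMap with hN
  obtain ⟨P, hP⟩ : ∃ P, Matrix.toEuclideanCLM (n := Fin n) (𝕜 := ℝ) P = N.starProjection :=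
    Matrix.toEuclideanCLM.surjective N.starProjection
  have happ : ∀ x, P *ᵥ x = (N.starProjection (WithLp.toLp 2 x)).ofLp := by
    intro x
    rw [← hP]
    rfl
  refine ⟨P, ?_, ?_, fun x => ?_, fun x hx => ?_⟩
  · have h : Matrix.toEuclideanCLM (n := Fin n) (𝕜 := ℝ) (star P) =
        Matrix.toEuclideanCLM (n := Fin n) (𝕜 := ℝ) P := by
      rw [map_star, hP]
      exact isSelfAdjoint_starProjection N
    have := Matrix.toEuclideanCLM.injective h
    rwa [Matrix.star_eq_conjTranspose, Matrix.conjTranspose_eq_transpose_of_trivial] at this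
  · have h : Matrix.toEuclideanCLM (n := Fin n) (𝕜 := ℝ) (P * P) =
        Matrix.toEuclideanCLM (n := Fin n) (𝕜 := ℝ) P := by
      rw [map_mul, hP]
      exact N.isIdempotentElem_starProjection
    exact Matrix.toEuclideanCLM.injective h
  · rw [happ]
    exact N.starProjection_apply_mem _
  · rw [happ, Submodule.starProjection_eq_self_iff.2]
    exact hx

/-- The quadratic form of the monic pencil with coefficients `A` is nonnegative on the closure of
the invertibility set. -/
def PencilNonneg {g δ l : ℕ} (p : NCMatPoly g δ) (A : Fin g → Matrix (Fin l) (Fin l) ℝ) : Prop :=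
  ∀ (m : ℕ) (Y : SymTuple g m), Y ∈ closure (invertibilitySet p m) →
    ∀ V : Matrix (Fin m) (Fin l) ℝ,
      0 ≤ (Vᵀ * V).trace + ∑ j, (A j * (Vᵀ * Y.1 j * V)).trace

/-- The scalar tuple with entry `s` in position `j`. -/
noncomputable def scalarTuple {g : ℕ} (j : Fin g) : ℝ →ₗ[ℝ] SymTuple g 1 :=
  symPart g 1 ∘ₗ LinearMap.single ℝ (fun _ => Matrix (Fin 1) (Fin 1) ℝ) j ∘ₗ
    LinearMap.toSpanSingleton ℝ _ 1

theorem scalarTuple_apply {g : ℕ} (j i : Fin g) (s : ℝ) :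
    (scalarTuple j s).1 i = if i = j then s • 1 else 0 := by
  change (1 / 2 : ℝ) • ((Pi.single j (s • 1) : Fin g → Matrix (Fin 1) (Fin 1) ℝ) i +
    ((Pi.single j (s • 1) : Fin g → Matrix (Fin 1) (Fin 1) ℝ) i)ᵀ) = _
  by_cases h : i = j
  · subst h
    simp only [Pi.single_eq_same, if_true, Matrix.transpose_smul, Matrix.transpose_one]
    module
  · simp [h]

theorem exists_scalarTuple_mem {g δ : ℕ} {p : NCMatPoly g δ} (hp0 : IsUnit (constTerm p))
    (j : Fin g) : ∃ s : ℝ, 0 < s ∧ scalarTuple j s ∈ closure (invertibilitySet p 1) ∧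
      scalarTuple j (-s) ∈ closure (invertibilitySet p 1) := by
  have hc : Continuous (scalarTuple j : ℝ →ₗ[ℝ] SymTuple g 1) :=
    LinearMap.continuous_of_finiteDimensional _
  have hopen := isOpen_invertibilitySet p 1 (g := g)
  have h1 : ∀ᶠ s in nhds (0 : ℝ), scalarTuple j s ∈ invertibilitySet p 1 :=
    hc.continuousAt.eventually_mem
      (by rw [map_zero]; exact hopen.mem_nhds (zero_mem_invertibilitySet hp0 1))
  have h2 : ∀ᶠ s in nhds (0 : ℝ), scalarTuple j (-s) ∈ invertibilitySet p 1 :=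
    (hc.comp continuous_neg).continuousAt.eventually_mem
      (by
        simp only [Function.comp_apply, neg_zero, map_zero]
        exact hopen.mem_nhds (zero_mem_invertibilitySet hp0 1))
  obtain ⟨s, ⟨hs1, hs2⟩, hs⟩ :=
    ((((h1.and h2).filter_mono nhdsWithin_le_nhds).and
      (self_mem_nhdsWithin : Set.Ioi (0 : ℝ) ∈ nhdsWithin 0 (Set.Ioi 0)))).exists
  exact ⟨s, hs, subset_closure hs1, subset_closure hs2⟩

theorem trace_mul_replicateRow {n : ℕ} (T : Matrix (Fin n) (Fin n) ℝ) (x : Fin n → ℝ) :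
    (T * ((Matrix.replicateRow (Fin 1) x)ᵀ * Matrix.replicateRow (Fin 1) x)).trace =
      x ⬝ᵥ T *ᵥ x := by
  simp only [Matrix.trace, Matrix.diag, Matrix.mul_apply, dotProduct, Matrix.mulVec,
    Matrix.transpose_apply, Matrix.replicateRow_apply, Finset.univ_unique, Finset.sum_singleton,
    Finset.mul_sum]
  exact Finset.sum_congr rfl fun a _ => Finset.sum_congr rfl fun b _ => by ring

theorem form_mulVec_nonneg {g δ n : ℕ} {p : NCMatPoly g δ} (hp0 : IsUnit (constTerm p))
    {T : Matrix (Fin n) (Fin n) ℝ} {Λ : Fin g → Matrix (Fin n) (Fin n) ℝ}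
    (hform : ∀ (m : ℕ) (Y : SymTuple g m), Y ∈ closure (invertibilitySet p m) →
      ∀ V : Matrix (Fin m) (Fin n) ℝ,
        ∑ j, (Λ j * (Vᵀ * Y.1 j * V)).trace ≤ (T * (Vᵀ * V)).trace) (x : Fin n → ℝ) :
    0 ≤ x ⬝ᵥ T *ᵥ x := by
  have h := hform 1 0 (subset_closure (zero_mem_invertibilitySet hp0 1))
    (Matrix.replicateRow (Fin 1) x)
  rw [trace_mul_replicateRow] at h
  simpa using h

/-- Small scalar points `±s` on the `j`-th axis lie in the set, so `T ± sΛ_j` are both positive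
semidefinite. On `ker T` the quadratic form of `Λ_j` therefore vanishes, and a null vector of a
semidefinite form is a kernel vector. -/
theorem mulVec_eq_zero_of_form {g δ n : ℕ} {p : NCMatPoly g δ} (hp0 : IsUnit (constTerm p))
    {T : Matrix (Fin n) (Fin n) ℝ} {Λ : Fin g → Matrix (Fin n) (Fin n) ℝ} (hT : Tᵀ = T)
    (hΛ : ∀ j, (Λ j)ᵀ = Λ j)
    (hform : ∀ (m : ℕ) (Y : SymTuple g m), Y ∈ closure (invertibilitySet p m) →
      ∀ V : Matrix (Fin m) (Fin n) ℝ,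
        ∑ j, (Λ j * (Vᵀ * Y.1 j * V)).trace ≤ (T * (Vᵀ * V)).trace)
    (j : Fin g) {x : Fin n → ℝ} (hx : T *ᵥ x = 0) : Λ j *ᵥ x = 0 := by
  obtain ⟨s, hs, h1, h2⟩ := exists_scalarTuple_mem hp0 j
  have key : ∀ r : ℝ, scalarTuple j r ∈ closure (invertibilitySet p 1) → ∀ y,
      r * (y ⬝ᵥ Λ j *ᵥ y) ≤ y ⬝ᵥ T *ᵥ y := by
    intro r hr y
    have h := hform 1 _ hr (Matrix.replicateRow (Fin 1) y)
    rw [Finset.sum_eq_single j (fun i _ hi => by simp [scalarTuple_apply, hi]) (by simp),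
      scalarTuple_apply, if_pos rfl, Matrix.mul_smul, Matrix.mul_one, Matrix.smul_mul,
      Matrix.mul_smul, Matrix.trace_smul, trace_mul_replicateRow, trace_mul_replicateRow,
      smul_eq_mul] at h
    exact h
  have hpsd : (T - s • Λ j).PosSemidef := by
    refine Matrix.PosSemidef.of_dotProduct_mulVec_nonneg ?_ fun y => ?_
    · simp [Matrix.IsHermitian, Matrix.conjTranspose_eq_transpose_of_trivial, hT, hΛ]
    · rw [Matrix.sub_mulVec, Matrix.smul_mulVec, star_trivial, dotProduct_sub, dotProduct_smul,
        smul_eq_mul]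
      linarith [key s h1 y]
  have hq : x ⬝ᵥ Λ j *ᵥ x = 0 := by
    have a1 := key s h1 x
    have a2 := key (-s) h2 x
    rw [hx, dotProduct_zero] at a1 a2
    nlinarith
  have hz : (T - s • Λ j) *ᵥ x = 0 := by
    rw [← hpsd.dotProduct_mulVec_zero_iff, Matrix.sub_mulVec, Matrix.smul_mulVec, star_trivial,
      dotProduct_sub, dotProduct_smul, hq, hx]
    simp
  rw [Matrix.sub_mulVec, Matrix.smul_mulVec, hx, zero_sub, neg_eq_zero] at hz
  exact (smul_eq_zero.1 hz).resolve_left hs.ne'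

theorem isUnit_add_one_sub {n : ℕ} {T Q : Matrix (Fin n) (Fin n) ℝ} (hT : Tᵀ = T)
    (hQT : Q * T = T) (hQQ : Q * Q = Q) (hQmem : ∀ x, ∃ y, T *ᵥ y = Q *ᵥ x) :
    IsUnit (T + (1 - Q)) := by
  have hQT' : Q * (T + (1 - Q)) = T := by
    rw [Matrix.mul_add, hQT, Matrix.mul_sub, hQQ, Matrix.mul_one, sub_self, add_zero]
  rw [Matrix.isUnit_iff_isUnit_det, isUnit_iff_ne_zero]
  intro hdet
  obtain ⟨v, hv, hv0⟩ := Matrix.exists_mulVec_eq_zero_iff.2 hdet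
  have h1 : T *ᵥ v = 0 := by rw [← hQT', ← Matrix.mulVec_mulVec, hv0, Matrix.mulVec_zero]
  rw [Matrix.add_mulVec, h1, zero_add, Matrix.sub_mulVec, Matrix.one_mulVec, sub_eq_zero] at hv0
  obtain ⟨y, hy⟩ := hQmem v
  rw [← hv0] at hy
  apply hv
  rw [← dotProduct_self_eq_zero]
  nth_rw 1 [← hy]
  rw [← hT, Matrix.mulVec_transpose, ← Matrix.dotProduct_mulVec, h1, dotProduct_zero]

/-- A dominating form can be normalised to a monic pencil, keeping track of kernels. -/
theorem exists_monic_of_form {g δ n : ℕ} {p : NCMatPoly g δ} (hp0 : IsUnit (constTerm p))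
    {T : Matrix (Fin n) (Fin n) ℝ} {Λ : Fin g → Matrix (Fin n) (Fin n) ℝ} (hT : Tᵀ = T)
    (hΛ : ∀ j, (Λ j)ᵀ = Λ j)
    (hform : ∀ (m : ℕ) (Y : SymTuple g m), Y ∈ closure (invertibilitySet p m) →
      ∀ V : Matrix (Fin m) (Fin n) ℝ,
        ∑ j, (Λ j * (Vᵀ * Y.1 j * V)).trace ≤ (T * (Vᵀ * V)).trace) :
    ∃ A : Fin g → Matrix (Fin n) (Fin n) ℝ, (∀ j, (A j)ᵀ = A j) ∧ PencilNonneg p A ∧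
      ∀ (m : ℕ) (Y : SymTuple g m) (R : Matrix (Fin m) (Fin n) ℝ), R * T ≠ 0 →
        R * T = ∑ j, Y.1 j * (R * Λ j) →
        ∃ V : Matrix (Fin m) (Fin n) ℝ, V ≠ 0 ∧ V + ∑ j, Y.1 j * V * A j = 0 := by
  have hker : ∀ j x, T *ᵥ x = 0 → Λ j *ᵥ x = 0 := fun j x hx =>
    mulVec_eq_zero_of_form hp0 hT hΛ hform j hx
  -- `T` may be singular. Adding the projection `1 - Q` onto its kernel makes it invertible, and
  -- every `Λ_j` lives on the range of `Q`, so nothing is lost.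
  obtain ⟨Q, hQ, hQQ, hQmem, hQfix⟩ := exists_projection (LinearMap.range T.mulVecLin)
  have hQT : Q * T = T := by
    refine Matrix.ext_of_mulVec_single fun i => ?_
    rw [← Matrix.mulVec_mulVec]
    exact hQfix _ ⟨_, rfl⟩
  have hTQ : T * Q = T := by
    have := congrArg Matrix.transpose hQT
    rwa [Matrix.transpose_mul, hQ, hT] at this
  have hΛQ : ∀ j, Λ j * Q = Λ j := by
    intro j
    have : Λ j * (1 - Q) = 0 := by
      refine Matrix.ext_of_mulVec_single fun i => ?_
      rw [← Matrix.mulVec_mulVec, hker, Matrix.zero_mulVec]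
      rw [Matrix.mulVec_mulVec, Matrix.mul_sub, hTQ, Matrix.mul_one, sub_self, Matrix.zero_mulVec]
    rw [Matrix.mul_sub, Matrix.mul_one, sub_eq_zero] at this
    exact this.symm
  have hQΛ : ∀ j, Q * Λ j = Λ j := by
    intro j
    have := congrArg Matrix.transpose (hΛQ j)
    rwa [Matrix.transpose_mul, hQ, hΛ] at this
  have hQc : (1 - Q)ᵀ * (1 - Q) = 1 - Q := by
    simp [Matrix.transpose_sub, hQ, Matrix.mul_sub, Matrix.sub_mul, hQQ]
  have hQpsd : (1 - Q).PosSemidef := by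
    have h := posSemidef_transpose_mul_self (1 - Q)
    rwa [hQc] at h
  have hTpsd : T.PosSemidef := Matrix.PosSemidef.of_dotProduct_mulVec_nonneg
    (by rw [Matrix.IsHermitian, Matrix.conjTranspose_eq_transpose_of_trivial, hT])
    (form_mulVec_nonneg hp0 hform)
  have hQT' : Q * (T + (1 - Q)) = T := by
    rw [Matrix.mul_add, hQT, Matrix.mul_sub, hQQ, Matrix.mul_one, sub_self, add_zero]
  have hunit := isUnit_add_one_sub hT hQT hQQ hQmem
  obtain ⟨C, hC⟩ := exists_eq_transpose_mul_self (hTpsd.add hQpsd)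
  obtain ⟨D, hDC⟩ : ∃ D : Matrix (Fin n) (Fin n) ℝ, D * C = 1 := by
    obtain ⟨G, hG⟩ := hunit.exists_left_inv
    exact ⟨G * Cᵀ, by rw [Matrix.mul_assoc, ← hC, hG]⟩
  have hCD : C * D = 1 := mul_eq_one_comm.1 hDC
  have hCDt : Cᵀ * Dᵀ = 1 := by rw [← Matrix.transpose_mul, hDC, Matrix.transpose_one]
  have hDCt : Dᵀ * Cᵀ = 1 := by rw [← Matrix.transpose_mul, hCD, Matrix.transpose_one]
  refine ⟨fun j => -(Dᵀ * Λ j * D), fun j => ?_, fun m Y hY V => ?_, fun m Y R hRT hR => ?_⟩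
  · simp [Matrix.transpose_mul, hΛ, Matrix.mul_assoc]
  · have h := hform m Y hY (V * Dᵀ)
    have e1 : (Vᵀ * V).trace = (T * ((V * Dᵀ)ᵀ * (V * Dᵀ))).trace +
        ((1 - Q) * ((V * Dᵀ)ᵀ * (V * Dᵀ))).trace := by
      rw [← Matrix.trace_add, ← Matrix.add_mul, hC, Matrix.mul_assoc, Matrix.trace_mul_comm Cᵀ]
      congr 1
      have : C * ((V * Dᵀ)ᵀ * (V * Dᵀ)) * Cᵀ = (C * D) * (Vᵀ * V) * (Dᵀ * Cᵀ) := by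
        simp only [Matrix.transpose_mul, Matrix.transpose_transpose, Matrix.mul_assoc]
      rw [this, hCD, hDCt, Matrix.one_mul, Matrix.mul_one]
    have e2 : 0 ≤ ((1 - Q) * ((V * Dᵀ)ᵀ * (V * Dᵀ))).trace := by
      have : ((1 - Q) * ((V * Dᵀ)ᵀ * (V * Dᵀ))).trace =
          ((V * Dᵀ * (1 - Q))ᵀ * (V * Dᵀ * (1 - Q))).trace := by
        conv_lhs => rw [← hQc, Matrix.mul_assoc, Matrix.trace_mul_comm, Matrix.mul_assoc]
        have hQt : (1 - Q)ᵀ = 1 - Q := by simp [Matrix.transpose_sub, hQ]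
        rw [Matrix.transpose_mul (V * Dᵀ), hQt]
        simp only [Matrix.mul_assoc]
      rw [this]
      exact (posSemidef_transpose_mul_self (V * Dᵀ * (1 - Q))).trace_nonneg
    have e3 : ∀ j, (-(Dᵀ * Λ j * D) * (Vᵀ * Y.1 j * V)).trace =
        -(Λ j * ((V * Dᵀ)ᵀ * Y.1 j * (V * Dᵀ))).trace := by
      intro j
      rw [Matrix.neg_mul, Matrix.trace_neg, Matrix.mul_assoc Dᵀ, Matrix.mul_assoc Dᵀ,
        Matrix.trace_mul_comm Dᵀ]
      simp only [Matrix.transpose_mul, Matrix.transpose_transpose, Matrix.mul_assoc]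
    simp only [e3, Finset.sum_neg_distrib]
    linarith
  -- Since `T + (1 - Q) = CᵀC` and `D = C⁻¹`, this witness equals `RTD`, and the relation for `RT`
  -- becomes the kernel equation after right multiplication by `D`.
  · refine ⟨R * Q * Cᵀ, fun h0 => hRT ?_, ?_⟩
    · have : R * Q * Cᵀ * Dᵀ * T = R * T := by
        rw [Matrix.mul_assoc (R * Q), hCDt, Matrix.mul_one, Matrix.mul_assoc, hQT]
      rw [← this, h0, Matrix.zero_mul, Matrix.zero_mul]
    · have e1 : R * Q * Cᵀ = R * T * D := by
        rw [← hQT', hC]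
        simp only [Matrix.mul_assoc, hCD, Matrix.mul_one]
      have e2 : ∀ j, Y.1 j * (R * Q * Cᵀ) * -(Dᵀ * Λ j * D) = -(Y.1 j * (R * Λ j) * D) := by
        intro j
        have : Y.1 j * (R * Q * Cᵀ) * (Dᵀ * Λ j * D) =
            Y.1 j * (R * (Q * ((Cᵀ * Dᵀ) * Λ j))) * D := by
          simp only [Matrix.mul_assoc]
        rw [Matrix.mul_neg, this, hCDt, Matrix.one_mul, hQΛ]
      simp only [e2, Finset.sum_neg_distrib]
      rw [← Matrix.sum_mul, ← hR, e1, add_neg_cancel]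

/-! ### Row polynomials of bounded degree and boundary pairs -/

/-- Noncommutative polynomials of degree at most `d`. -/
def ncDegreeLE (g d : ℕ) : Submodule ℝ (NCPoly g) :=
  (Submodule.span ℝ (insert 1 (Set.range (FreeAlgebra.ι ℝ)))) ^ d

theorem one_mem_ncDegreeLE_one (g : ℕ) : (1 : NCPoly g) ∈
    Submodule.span ℝ (insert 1 (Set.range (FreeAlgebra.ι ℝ (X := Fin g)))) :=
  Submodule.subset_span (Set.mem_insert _ _)

theorem ncDegreeLE_mono {g d e : ℕ} (h : d ≤ e) : ncDegreeLE g d ≤ ncDegreeLE g e :=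
  pow_le_pow_right' (Submodule.one_le.2 (one_mem_ncDegreeLE_one g)) h

theorem one_mem_ncDegreeLE (g d : ℕ) : (1 : NCPoly g) ∈ ncDegreeLE g d :=
  ncDegreeLE_mono (Nat.zero_le d) (by simp [ncDegreeLE])

theorem ι_mul_mem_ncDegreeLE {g d : ℕ} (j : Fin g) {q : NCPoly g} (hq : q ∈ ncDegreeLE g d) :
    FreeAlgebra.ι ℝ j * q ∈ ncDegreeLE g (d + 1) := by
  rw [ncDegreeLE, pow_succ']
  exact Submodule.mul_mem_mul (Submodule.subset_span (Set.mem_insert_of_mem _ ⟨j, rfl⟩)) hq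

theorem finite_ncDegreeLE (g d : ℕ) : (ncDegreeLE g d).FG :=
  Submodule.FG.pow (Submodule.fg_span ((Set.finite_range _).insert _)) d

theorem exists_mem_ncDegreeLE {g : ℕ} (q : NCPoly g) : ∃ d, q ∈ ncDegreeLE g d := by
  induction q using FreeAlgebra.induction with
  | grade0 r =>
    refine ⟨0, ?_⟩
    rw [Algebra.algebraMap_eq_smul_one]
    exact Submodule.smul_mem _ _ (one_mem_ncDegreeLE g 0)
  | grade1 x =>
    refine ⟨1, ?_⟩
    rw [ncDegreeLE, pow_one]
    exact Submodule.subset_span (Set.mem_insert_of_mem _ ⟨x, rfl⟩)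
  | mul a b ha hb =>
    obtain ⟨d, hd⟩ := ha
    obtain ⟨e, he⟩ := hb
    refine ⟨d + e, ?_⟩
    rw [ncDegreeLE, pow_add]
    exact Submodule.mul_mem_mul hd he
  | add a b ha hb =>
    obtain ⟨d, hd⟩ := ha
    obtain ⟨e, he⟩ := hb
    exact ⟨max d e, Submodule.add_mem _ (ncDegreeLE_mono (le_max_left _ _) hd)
      (ncDegreeLE_mono (le_max_right _ _) he)⟩

theorem exists_forall_mem_ncDegreeLE {g δ : ℕ} (p : NCMatPoly g δ) :
    ∃ d, ∀ i k, p i k ∈ ncDegreeLE g d := by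
  choose d hd using fun a : Fin δ × Fin δ => exists_mem_ncDegreeLE (p a.1 a.2)
  exact ⟨Finset.univ.sup d, fun i k =>
    ncDegreeLE_mono (Finset.le_sup (f := d) (Finset.mem_univ (i, k))) (hd (i, k))⟩

/-- Row polynomials of degree at most `d`. -/
def rowDegreeLE (g δ d : ℕ) : Submodule ℝ (Fin δ → NCPoly g) :=
  Submodule.pi Set.univ fun _ => ncDegreeLE g d

theorem mem_rowDegreeLE {g δ d : ℕ} {q : Fin δ → NCPoly g} :
    q ∈ rowDegreeLE g δ d ↔ ∀ i, q i ∈ ncDegreeLE g d := by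
  simp [rowDegreeLE, Submodule.mem_pi]

instance (g δ d : ℕ) : FiniteDimensional ℝ (rowDegreeLE g δ d) :=
  Module.Finite.iff_fg.2 (Submodule.fg_pi fun _ => finite_ncDegreeLE g d)

/-- The value `q(X)v` of a row polynomial. -/
def rowEval {g δ n : ℕ} (X : SymTuple g n) (v : Fin δ → Fin n → ℝ) :
    (Fin δ → NCPoly g) →ₗ[ℝ] (Fin n → ℝ) where
  toFun q := ∑ i, FreeAlgebra.lift ℝ X.1 (q i) *ᵥ v i
  map_add' q r := by simp [Matrix.add_mulVec, Finset.sum_add_distrib]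
  map_smul' c q := by simp [Matrix.smul_mulVec, Finset.smul_sum]

theorem rowEval_apply {g δ n : ℕ} (X : SymTuple g n) (v : Fin δ → Fin n → ℝ)
    (q : Fin δ → NCPoly g) : rowEval X v q = ∑ i, FreeAlgebra.lift ℝ X.1 (q i) *ᵥ v i := rfl

theorem rowEval_single {g δ n : ℕ} (X : SymTuple g n) (v : Fin δ → Fin n → ℝ) (i : Fin δ)
    (q : NCPoly g) : rowEval X v (Pi.single i q) = FreeAlgebra.lift ℝ X.1 q *ᵥ v i := by
  rw [rowEval_apply, Finset.sum_eq_single i]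
  · simp
  · intro k _ hk
    simp [hk]
  · simp

theorem rowEval_ι_mul {g δ n : ℕ} (X : SymTuple g n) (v : Fin δ → Fin n → ℝ) (j : Fin g)
    (q : Fin δ → NCPoly g) :
    rowEval X v (fun i => FreeAlgebra.ι ℝ j * q i) = X.1 j *ᵥ rowEval X v q := by
  simp only [rowEval_apply, map_mul, FreeAlgebra.lift_ι_apply, Matrix.mulVec_sum,
    Matrix.mulVec_mulVec]

theorem mulVec_rowEval_of_intertwine {g δ m n : ℕ} {Z : SymTuple g m} {X : SymTuple g n}
    {E : Matrix (Fin m) (Fin n) ℝ} (h : ∀ j, Z.1 j * E = E * X.1 j) (v : Fin δ → Fin n → ℝ)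
    (q : Fin δ → NCPoly g) :
    rowEval Z (fun i => E *ᵥ v i) q = E *ᵥ rowEval X v q := by
  simp only [rowEval_apply, Matrix.mulVec_sum, Matrix.mulVec_mulVec, lift_mul_of_intertwine h]

theorem not_isUnit_ncEval_iff {g δ n : ℕ} {p : NCMatPoly g δ} {X : SymTuple g n} :
    ¬ IsUnit (ncEval p X) ↔ ∃ v : Fin δ → Fin n → ℝ, v ≠ 0 ∧ ∀ i, rowEval X v (p i) = 0 := by
  have key : ∀ (v : Fin δ → Fin n → ℝ) (i : Fin δ) (a : Fin n),
      (ncEval p X *ᵥ fun b => v b.1 b.2) (i, a) = rowEval X v (p i) a := by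
    intro v i a
    simp [rowEval_apply, Matrix.mulVec, dotProduct, ncEval, Fintype.sum_prod_type]
  rw [Matrix.isUnit_iff_isUnit_det, isUnit_iff_ne_zero, not_not,
    ← Matrix.exists_mulVec_eq_zero_iff]
  constructor
  · rintro ⟨w, hw, h⟩
    refine ⟨fun i a => w (i, a), fun h0 => hw ?_, fun i => ?_⟩
    · ext ⟨i, a⟩
      exact congrFun (congrFun h0 i) a
    · ext a
      rw [← key, h]
      rfl
  · rintro ⟨v, hv, h⟩
    refine ⟨fun b => v b.1 b.2, fun h0 => hv ?_, ?_⟩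
    · ext i a
      exact congrFun h0 (i, a)
    · ext ⟨i, a⟩
      rw [key, h]
      rfl

/-- Boundary points of the invertibility set together with a kernel vector. -/
structure IsBoundaryPair {g δ n : ℕ} (p : NCMatPoly g δ) (X : SymTuple g n)
    (v : Fin δ → Fin n → ℝ) : Prop where
  mem_closure : X ∈ closure (invertibilitySet p n)
  ne_zero : v ≠ 0
  rowEval_eq_zero : ∀ i, rowEval X v (p i) = 0

/-- Compressing to the space of values of row polynomials of degree at most `d` does not change
these values. -/
theorem rowEval_conjTuple_projection {g δ n d : ℕ} {X : SymTuple g n} {v : Fin δ → Fin n → ℝ}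
    {P : Matrix (Fin n) (Fin n) ℝ} (hP : Pᵀ = P)
    (hfix : ∀ x ∈ (rowDegreeLE g δ d).map (rowEval X v), P *ᵥ x = x) {q : Fin δ → NCPoly g}
    (hq : q ∈ rowDegreeLE g δ d) : rowEval (conjTuple P X) v q = rowEval X v q := by
  have hfix' : ∀ r ∈ ncDegreeLE g d, ∀ i,
      P *ᵥ (FreeAlgebra.lift ℝ X.1 r *ᵥ v i) = FreeAlgebra.lift ℝ X.1 r *ᵥ v i := by
    intro r hr i
    apply hfix
    rw [← rowEval_single]
    refine Submodule.mem_map_of_mem (mem_rowDegreeLE.2 fun k => ?_)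
    by_cases hk : k = i
    · subst hk
      simpa using hr
    · simp [hk]
  have key : ∀ e ≤ d, ∀ r ∈ ncDegreeLE g e, ∀ i,
      FreeAlgebra.lift ℝ (conjTuple P X).1 r *ᵥ v i = FreeAlgebra.lift ℝ X.1 r *ᵥ v i := by
    intro e
    induction e with
    | zero =>
      intro _ r hr i
      rw [ncDegreeLE, pow_zero, Submodule.mem_one] at hr
      obtain ⟨c, rfl⟩ := hr
      simp only [AlgHom.commutes]
    | succ e ih =>
      intro he r hr i
      rw [ncDegreeLE, pow_succ'] at hr
      induction hr using Submodule.mul_induction_on' with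
      | add a ha b hb ha' hb' => simp only [map_add, Matrix.add_mulVec, ha', hb']
      | mem_mul_mem a ha b hb =>
        have hb : b ∈ ncDegreeLE g e := hb
        rw [map_mul, map_mul, ← Matrix.mulVec_mulVec, ← Matrix.mulVec_mulVec,
          ih (by omega) b hb i]
        induction ha using Submodule.span_induction with
        | zero => simp
        | add a a' _ _ h1 h2 => simp only [map_add, Matrix.add_mulVec, h1, h2]
        | smul c a _ h1 => simp only [map_smul, Matrix.smul_mulVec, h1]
        | mem a ha =>
          rcases ha with rfl | ⟨j, rfl⟩
          · simp
          -- `P` fixes both `b(X)v_i` and `X_j b(X)v_i`, as `b` and `x_j b` have degree at most `d`;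
          -- so `P X_j P` acts on `b(X)v_i` as `X_j` does.
          · have h1 := hfix' b (ncDegreeLE_mono (by omega) hb) i
            have h2 := hfix' _ (ncDegreeLE_mono he (ι_mul_mem_ncDegreeLE j hb)) i
            rw [map_mul, FreeAlgebra.lift_ι_apply, ← Matrix.mulVec_mulVec] at h2
            rw [FreeAlgebra.lift_ι_apply, FreeAlgebra.lift_ι_apply, conjTuple_apply, hP,
              ← Matrix.mulVec_mulVec, h1, ← Matrix.mulVec_mulVec, h2]
  simp only [rowEval_apply]
  exact Finset.sum_congr rfl fun i _ => key d le_rfl _ (mem_rowDegreeLE.1 hq i) i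

/-! ### Dominating pairs and the pencil of one pair -/

theorem exists_comp_eq_of_ker_le {V W W' : Type*} [AddCommGroup V] [Module ℝ V] [AddCommGroup W]
    [Module ℝ W] [AddCommGroup W'] [Module ℝ W'] (a : V →ₗ[ℝ] W) (b : V →ₗ[ℝ] W')
    (h : LinearMap.ker a ≤ LinearMap.ker b) : ∃ c : W →ₗ[ℝ] W', c ∘ₗ a = b := by
  obtain ⟨c, hc⟩ := LinearMap.exists_extend
    (((LinearMap.ker a).liftQ b h) ∘ₗ a.quotKerEquivRange.symm.toLinearMap)
  refine ⟨c, LinearMap.ext fun x => ?_⟩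
  have := LinearMap.congr_fun hc ⟨a x, x, rfl⟩
  simp only [LinearMap.comp_apply, Submodule.subtype_apply] at this
  rw [LinearMap.comp_apply, this]
  have e : a.quotKerEquivRange.symm ⟨a x, x, rfl⟩ = Submodule.Quotient.mk x := by
    rw [LinearEquiv.symm_apply_eq]
    rfl
  simp [e]

/-- Boundary pairs annihilated by all row polynomials in `J`. -/
def annihilatedPairs {g δ : ℕ} (p : NCMatPoly g δ) (J : Submodule ℝ (Fin δ → NCPoly g)) (n : ℕ) :
    Set (SymTuple g n × (Fin δ → Fin n → ℝ)) :=
  {Xv | IsBoundaryPair p Xv.1 Xv.2 ∧ ∀ q ∈ J, rowEval Xv.1 Xv.2 q = 0}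

/-- Values at the direct sum are pairs of values, so its annihilator is the intersection of the two
annihilators. -/
theorem exists_directSum_annihilatedPairs {g δ m n : ℕ} {p : NCMatPoly g δ}
    (hp0 : IsUnit (constTerm p)) (hconv : HasConvexInvertibilitySet p)
    {J : Submodule ℝ (Fin δ → NCPoly g)} {X : SymTuple g m} {v : Fin δ → Fin m → ℝ}
    {Y : SymTuple g n} {w : Fin δ → Fin n → ℝ} (hX : (X, v) ∈ annihilatedPairs p J m)
    (hY : (Y, w) ∈ annihilatedPairs p J n) :
    ∃ Z u, (Z, u) ∈ annihilatedPairs p J (m + n) ∧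
      ∀ q, rowEval Z u q = 0 ↔ rowEval X v q = 0 ∧ rowEval Y w q = 0 := by
  have hE := inclLeft_transpose_mul_self m n
  have hF := inclRight_transpose_mul_self m n
  have hEF := inclLeft_transpose_mul_inclRight m n
  have hFE : (inclRight m n)ᵀ * inclLeft m n = 0 := by
    have := congrArg Matrix.transpose hEF
    simpa using this
  have hsum := incl_mul_transpose_add m n
  set E := inclLeft m n
  set F := inclRight m n
  set Z : SymTuple g (m + n) := conjTuple Eᵀ X + conjTuple Fᵀ Y with hZ
  have hZE : ∀ j, Z.1 j * E = E * X.1 j := fun j => by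
    change (Eᵀᵀ * X.1 j * Eᵀ + Fᵀᵀ * Y.1 j * Fᵀ) * E = _
    simp [Matrix.add_mul, Matrix.mul_assoc, hE, hFE]
  have hZF : ∀ j, Z.1 j * F = F * Y.1 j := fun j => by
    change (Eᵀᵀ * X.1 j * Eᵀ + Fᵀᵀ * Y.1 j * Fᵀ) * F = _
    simp [Matrix.add_mul, Matrix.mul_assoc, hF, hEF]
  set u : Fin δ → Fin (m + n) → ℝ := fun i => E *ᵥ v i + F *ᵥ w i with hu
  have hval : ∀ q, rowEval Z u q = E *ᵥ rowEval X v q + F *ᵥ rowEval Y w q := by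
    intro q
    rw [← mulVec_rowEval_of_intertwine hZE, ← mulVec_rowEval_of_intertwine hZF]
    simp only [rowEval_apply, hu, Matrix.mulVec_add, Finset.sum_add_distrib]
  have hEinv : ∀ x y, Eᵀ *ᵥ (E *ᵥ x + F *ᵥ y) = x := fun x y => by
    rw [Matrix.mulVec_add, Matrix.mulVec_mulVec, Matrix.mulVec_mulVec, hE, hEF]; simp
  have hFinv : ∀ x y, Fᵀ *ᵥ (E *ᵥ x + F *ᵥ y) = y := fun x y => by
    rw [Matrix.mulVec_add, Matrix.mulVec_mulVec, Matrix.mulVec_mulVec, hFE, hF]; simp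
  have hiff : ∀ q, rowEval Z u q = 0 ↔ rowEval X v q = 0 ∧ rowEval Y w q = 0 := by
    intro q
    rw [hval]
    constructor
    · intro h
      exact ⟨by rw [← hEinv (rowEval X v q) (rowEval Y w q), h, Matrix.mulVec_zero],
        by rw [← hFinv (rowEval X v q) (rowEval Y w q), h, Matrix.mulVec_zero]⟩
    · rintro ⟨h1, h2⟩
      rw [h1, h2]; simp
  refine ⟨Z, u, ⟨⟨?_, fun h0 => hX.1.ne_zero ?_, fun i => ?_⟩, fun q hq => ?_⟩, hiff⟩
  · exact cstarConvex_mem_closure hp0 hconv (by simpa using hsum) hX.1.mem_closure hY.1.mem_closure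
  · ext1 i
    change v i = 0
    rw [← hEinv (v i) (w i)]
    have : E *ᵥ v i + F *ᵥ w i = 0 := congrFun h0 i
    rw [this, Matrix.mulVec_zero]
  · exact (hiff _).2 ⟨hX.1.rowEval_eq_zero i, hY.1.rowEval_eq_zero i⟩
  · exact (hiff _).2 ⟨hX.2 q hq, hY.2 q hq⟩

/-- A pair is dominating if its row polynomials of degree at most `e` annihilate all other pairs. -/
theorem exists_dominating_pair {g δ : ℕ} {p : NCMatPoly g δ} (hp0 : IsUnit (constTerm p))
    (hconv : HasConvexInvertibilitySet p) (J : Submodule ℝ (Fin δ → NCPoly g)) (e : ℕ)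
    (hne : ∃ n, (annihilatedPairs p J n).Nonempty) :
    ∃ n X v, (X, v) ∈ annihilatedPairs p J n ∧
      ∀ m Y w, (Y, w) ∈ annihilatedPairs p J m →
        ∀ q ∈ rowDegreeLE g δ e, rowEval X v q = 0 → rowEval Y w q = 0 := by
  classical
  -- Choose a pair whose annihilator in degree at most `e` has least dimension. Summing it with any
  -- other pair cannot shrink that annihilator, which is therefore contained in the other's.
  have hex : ∃ r : ℕ, ∃ n X v, (X, v) ∈ annihilatedPairs p J n ∧
      Module.finrank ℝ ↥(rowDegreeLE g δ e ⊓ LinearMap.ker (rowEval X v)) = r := by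
    obtain ⟨n, ⟨X, v⟩, h⟩ := hne
    exact ⟨_, n, X, v, h, rfl⟩
  obtain ⟨n, X, v, hX, hr⟩ := Nat.find_spec hex
  refine ⟨n, X, v, hX, fun m Y w hY q hq hq0 => ?_⟩
  obtain ⟨Z, u, hZ, hiff⟩ := exists_directSum_annihilatedPairs hp0 hconv hX hY
  have hle : rowDegreeLE g δ e ⊓ LinearMap.ker (rowEval Z u) ≤
      rowDegreeLE g δ e ⊓ LinearMap.ker (rowEval X v) := fun q hq =>
    ⟨hq.1, ((hiff q).1 hq.2).1⟩
  have hmin := Nat.find_min' hex ⟨_, Z, u, hZ, rfl⟩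
  rw [← hr] at hmin
  have heq := Submodule.eq_of_le_of_finrank_le hle hmin
  have hmem : q ∈ rowDegreeLE g δ e ⊓ LinearMap.ker (rowEval Z u) := heq ▸ ⟨hq, hq0⟩
  exact ((hiff q).1 hmem.2).2

/-- Since `p` has degree at most `d`, `p(PXP)v = p(X)v = 0`. This supplies the point to separate. -/
theorem conjTuple_projection_not_mem {g δ n d : ℕ} {p : NCMatPoly g δ}
    (hd : ∀ i k, p i k ∈ ncDegreeLE g d) {X : SymTuple g n} {v : Fin δ → Fin n → ℝ}
    (hX : IsBoundaryPair p X v) {P : Matrix (Fin n) (Fin n) ℝ} (hP : Pᵀ = P)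
    (hfix : ∀ x ∈ (rowDegreeLE g δ d).map (rowEval X v), P *ᵥ x = x) :
    conjTuple P X ∉ invertibilitySet p n := fun h =>
  not_isUnit_ncEval_iff.2 ⟨v, hX.ne_zero, fun i => by
    rw [rowEval_conjTuple_projection hP hfix (mem_rowDegreeLE.2 (hd i)), hX.rowEval_eq_zero]⟩
    (isUnit_of_mem_invertibilitySet h)

/-- The pencil attached to a dominating pair: it is singular at every other pair that is not
annihilated by the rows `r`, and some row of `r` does not annihilate the dominating pair. -/
theorem exists_pencil_of_dominating_pair {g δ d n : ℕ} {p : NCMatPoly g δ}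
    (hp0 : IsUnit (constTerm p)) (hconv : HasConvexInvertibilitySet p)
    (hd : ∀ i k, p i k ∈ ncDegreeLE g d) {X : SymTuple g n} {v : Fin δ → Fin n → ℝ}
    (hX : IsBoundaryPair p X v) :
    ∃ (A : Fin g → Matrix (Fin n) (Fin n) ℝ) (r : Fin n → Fin δ → NCPoly g),
      (∀ j, (A j)ᵀ = A j) ∧ PencilNonneg p A ∧ (∀ k, r k ∈ rowDegreeLE g δ d) ∧
      (∃ k, rowEval X v (r k) ≠ 0) ∧
      ∀ m (Y : SymTuple g m) (w : Fin δ → Fin m → ℝ),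
        (∀ q ∈ rowDegreeLE g δ (d + 1), rowEval X v q = 0 → rowEval Y w q = 0) →
        (∀ k, rowEval Y w (r k) = 0) ∨
          ∃ V : Matrix (Fin m) (Fin n) ℝ, V ≠ 0 ∧ V + ∑ j, Y.1 j * V * A j = 0 := by
  obtain ⟨P, hP, hPP, hPmem, hfix⟩ := exists_projection ((rowDegreeLE g δ d).map (rowEval X v))
  obtain ⟨T, Λ, hT, hΛ, hPT, hPΛ, hT0, hTX, hform⟩ := exists_separating_form hp0 hconv
    hX.mem_closure hP hPP (conjTuple_projection_not_mem hd hX hP hfix)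
  obtain ⟨A, hA, hApos, hAker⟩ := exists_monic_of_form hp0 hT hΛ hform
  have hTmem : ∀ x, ∃ q ∈ rowDegreeLE g δ d, rowEval X v q = T *ᵥ x := by
    intro x
    rw [← hPT, ← Matrix.mulVec_mulVec]
    exact hPmem _
  have hΛmem : ∀ j x, ∃ q ∈ rowDegreeLE g δ d, rowEval X v q = Λ j *ᵥ x := by
    intro j x
    rw [← hPΛ, ← Matrix.mulVec_mulVec]
    exact hPmem _
  -- The rows `r k` represent the columns of `T` as values at `(X, v)`. They depend on this pair
  -- only, so the exceptional set is the same for all `Y`.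
  choose r hr hrT using fun k : Fin n => hTmem (Pi.single k 1)
  refine ⟨A, r, hA, hApos, hr, ?_, fun m Y w hdom => ?_⟩
  · by_contra! hall
    refine hT0 (Matrix.ext_of_mulVec_single fun k => ?_)
    rw [← hrT, hall, Matrix.zero_mulVec]
  · obtain ⟨c, hc⟩ := exists_comp_eq_of_ker_le
      ((rowEval X v).domRestrict (rowDegreeLE g δ (d + 1)))
      ((rowEval Y w).domRestrict (rowDegreeLE g δ (d + 1)))
      (fun q hq => hdom q.1 q.2 hq)
    set R := LinearMap.toMatrix' c with hR
    have hRval : ∀ q ∈ rowDegreeLE g δ (d + 1), R *ᵥ rowEval X v q = rowEval Y w q := by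
      intro q hq
      rw [hR, LinearMap.toMatrix'_mulVec]
      exact LinearMap.congr_fun hc ⟨q, hq⟩
    have hsucc : ∀ q ∈ rowDegreeLE g δ d, q ∈ rowDegreeLE g δ (d + 1) := fun q hq =>
      mem_rowDegreeLE.2 fun i => ncDegreeLE_mono (Nat.le_succ d) (mem_rowDegreeLE.1 hq i)
    -- The columns of `Λ_j` are values of rows of degree at most `d`, so multiplying by `x_j` stays
    -- within `d + 1`, where `R` sends values at `(X, v)` to values at `(Y, w)`.
    have hcomm : ∀ j, R * (X.1 j * Λ j) = Y.1 j * (R * Λ j) := by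
      intro j
      refine Matrix.ext_of_mulVec_single fun k => ?_
      obtain ⟨q, hq, hqΛ⟩ := hΛmem j (Pi.single k 1)
      rw [← Matrix.mulVec_mulVec, ← Matrix.mulVec_mulVec, ← Matrix.mulVec_mulVec,
        ← Matrix.mulVec_mulVec, ← hqΛ, ← rowEval_ι_mul, hRval _ (hsucc q hq), ← rowEval_ι_mul]
      exact hRval _ (mem_rowDegreeLE.2 fun i => ι_mul_mem_ncDegreeLE j (mem_rowDegreeLE.1 hq i))
    by_cases hRT : R * T = 0
    · left
      intro k
      rw [← hRval _ (hsucc _ (hr k)), hrT, Matrix.mulVec_mulVec, hRT, Matrix.zero_mulVec]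
    · right
      refine hAker m Y R hRT ?_
      conv_lhs => rw [hTX]
      rw [Matrix.mul_sum]
      exact Finset.sum_congr rfl fun j _ => hcomm j

/-! ### Induction producing one pencil -/

theorem exists_directSum_pencil {g δ k l : ℕ} {p : NCMatPoly g δ}
    {A : Fin g → Matrix (Fin k) (Fin k) ℝ} {B : Fin g → Matrix (Fin l) (Fin l) ℝ}
    (hA : ∀ j, (A j)ᵀ = A j) (hB : ∀ j, (B j)ᵀ = B j) (hApos : PencilNonneg p A)
    (hBpos : PencilNonneg p B) :
    ∃ C : Fin g → Matrix (Fin (k + l)) (Fin (k + l)) ℝ, (∀ j, (C j)ᵀ = C j) ∧ PencilNonneg p C ∧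
      ∀ (m : ℕ) (Y : SymTuple g m),
        ((∃ V : Matrix (Fin m) (Fin k) ℝ, V ≠ 0 ∧ V + ∑ j, Y.1 j * V * A j = 0) ∨
          ∃ V : Matrix (Fin m) (Fin l) ℝ, V ≠ 0 ∧ V + ∑ j, Y.1 j * V * B j = 0) →
        ∃ V : Matrix (Fin m) (Fin (k + l)) ℝ, V ≠ 0 ∧ V + ∑ j, Y.1 j * V * C j = 0 := by
  have hE := inclLeft_transpose_mul_self k l
  have hF := inclRight_transpose_mul_self k l
  have hEF := inclLeft_transpose_mul_inclRight k l
  have hFE : (inclRight k l)ᵀ * inclLeft k l = 0 := by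
    have := congrArg Matrix.transpose hEF
    simpa using this
  have hsum := incl_mul_transpose_add k l
  set E := inclLeft k l
  set F := inclRight k l
  refine ⟨fun j => E * A j * Eᵀ + F * B j * Fᵀ, fun j => ?_, fun m Y hY V => ?_, fun m Y h => ?_⟩
  · simp [Matrix.transpose_mul, hA, hB, Matrix.mul_assoc]
  · have h1 := hApos m Y hY (V * E)
    have h2 := hBpos m Y hY (V * F)
    have e0 : (Vᵀ * V).trace = ((V * E)ᵀ * (V * E)).trace + ((V * F)ᵀ * (V * F)).trace := by
      rw [← Matrix.one_mul (Vᵀ * V), ← hsum, Matrix.add_mul, Matrix.trace_add, Matrix.mul_assoc E,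
        Matrix.trace_mul_comm E, Matrix.mul_assoc F, Matrix.trace_mul_comm F]
      simp only [Matrix.transpose_mul, Matrix.mul_assoc]
    have e1 : ∀ j, ((E * A j * Eᵀ + F * B j * Fᵀ) * (Vᵀ * Y.1 j * V)).trace =
        (A j * ((V * E)ᵀ * Y.1 j * (V * E))).trace +
          (B j * ((V * F)ᵀ * Y.1 j * (V * F))).trace := by
      intro j
      rw [Matrix.add_mul, Matrix.trace_add, Matrix.mul_assoc E, Matrix.mul_assoc E,
        Matrix.trace_mul_comm E, Matrix.mul_assoc F, Matrix.mul_assoc F, Matrix.trace_mul_comm F]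
      simp only [Matrix.transpose_mul, Matrix.mul_assoc]
    simp only [e0, e1, Finset.sum_add_distrib]
    linarith
  · rcases h with ⟨V, hV, h⟩ | ⟨V, hV, h⟩
    · refine ⟨V * Eᵀ, fun h0 => hV ?_, ?_⟩
      · rw [← Matrix.mul_one V, ← hE, ← Matrix.mul_assoc, h0, Matrix.zero_mul]
      · have e : ∀ j, Y.1 j * (V * Eᵀ) * (E * A j * Eᵀ + F * B j * Fᵀ) =
            Y.1 j * V * A j * Eᵀ := by
          intro j
          rw [Matrix.mul_add, Matrix.mul_assoc E, Matrix.mul_assoc F, ← Matrix.mul_assoc _ E,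
            ← Matrix.mul_assoc _ F, Matrix.mul_assoc (Y.1 j) _ E, Matrix.mul_assoc (Y.1 j) _ F,
            Matrix.mul_assoc V, Matrix.mul_assoc V, hE, hEF]
          simp [Matrix.mul_assoc]
        simp only [e]
        rw [← Matrix.sum_mul, ← Matrix.add_mul, h, Matrix.zero_mul]
    · refine ⟨V * Fᵀ, fun h0 => hV ?_, ?_⟩
      · rw [← Matrix.mul_one V, ← hF, ← Matrix.mul_assoc, h0, Matrix.zero_mul]
      · have e : ∀ j, Y.1 j * (V * Fᵀ) * (E * A j * Eᵀ + F * B j * Fᵀ) =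
            Y.1 j * V * B j * Fᵀ := by
          intro j
          rw [Matrix.mul_add, Matrix.mul_assoc E, Matrix.mul_assoc F, ← Matrix.mul_assoc _ E,
            ← Matrix.mul_assoc _ F, Matrix.mul_assoc (Y.1 j) _ E, Matrix.mul_assoc (Y.1 j) _ F,
            Matrix.mul_assoc V, Matrix.mul_assoc V, hF, hFE]
          simp [Matrix.mul_assoc]
        simp only [e]
        rw [← Matrix.sum_mul, ← Matrix.add_mul, h, Matrix.zero_mul]

/-- Induction on a bound `c` for the codimension of `J`. The pencil of a dominating pair handles all
pairs except those killed also by its rows `r`; these form the same problem for a strictly larger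
`J`, and the two pencils are added. -/
theorem exists_pencil_of_annihilatedPairs {g δ d : ℕ} {p : NCMatPoly g δ}
    (hp0 : IsUnit (constTerm p)) (hconv : HasConvexInvertibilitySet p)
    (hd : ∀ i k, p i k ∈ ncDegreeLE g d) (c : ℕ) :
    ∀ J ≤ rowDegreeLE g δ d, Module.finrank ℝ (rowDegreeLE g δ d) ≤ Module.finrank ℝ J + c →
      ∃ (l : ℕ) (A : Fin g → Matrix (Fin l) (Fin l) ℝ), 1 ≤ l ∧ (∀ j, (A j)ᵀ = A j) ∧
        PencilNonneg p A ∧ ∀ m Y w, (Y, w) ∈ annihilatedPairs p J m →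
          ∃ V : Matrix (Fin m) (Fin l) ℝ, V ≠ 0 ∧ V + ∑ j, Y.1 j * V * A j = 0 := by
  induction c with
  | zero =>
    intro J hJ hfin
    obtain rfl : J = rowDegreeLE g δ d := Submodule.eq_of_le_of_finrank_le hJ hfin
    -- Now `J` contains the constant unit rows, which would force `w = 0`; there are no pairs, and
    -- the trivial pencil of size 1 serves.
    refine ⟨1, 0, le_rfl, by simp, fun m Y _ V => ?_, fun m Y w hY => absurd ?_ hY.1.ne_zero⟩
    · simpa using (posSemidef_transpose_mul_self V).trace_nonneg
    · ext1 i
      have := hY.2 (Pi.single i 1) (mem_rowDegreeLE.2 fun k => ?_)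
      · simpa [rowEval_single] using this
      · by_cases hk : k = i
        · subst hk
          simpa using one_mem_ncDegreeLE g d
        · simp [hk]
  | succ c ih =>
    intro J hJ hfin
    by_cases hne : ∃ n, (annihilatedPairs p J n).Nonempty
    · obtain ⟨n, X, v, hX, hdom⟩ := exists_dominating_pair hp0 hconv J (d + 1) hne
      obtain ⟨A, r, hA, hApos, hr, ⟨k, hk⟩, hAker⟩ :=
        exists_pencil_of_dominating_pair hp0 hconv hd hX.1
      set J' := J ⊔ Submodule.span ℝ (Set.range r) with hJ'
      have hJ'le : J' ≤ rowDegreeLE g δ d :=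
        sup_le hJ (Submodule.span_le.2 (by rintro _ ⟨k, rfl⟩; exact hr k))
      have : FiniteDimensional ℝ J' := Submodule.finiteDimensional_of_le hJ'le
      -- Some `r k` does not kill `(X, v)`, while all of `J` does.
      have hlt : J < J' := by
        refine lt_of_le_of_ne le_sup_left fun h => hk (hX.2 _ ?_)
        rw [h]
        exact Submodule.mem_sup_right (Submodule.subset_span ⟨k, rfl⟩)
      have := Submodule.finrank_lt_finrank_of_lt hlt
      obtain ⟨l, B, hl, hB, hBpos, hBker⟩ := ih J' hJ'le (by omega)
      obtain ⟨C, hC, hCpos, hCker⟩ := exists_directSum_pencil hA hB hApos hBpos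
      refine ⟨n + l, C, by omega, hC, hCpos, fun m Y w hY => hCker m Y ?_⟩
      rcases hAker m Y w (hdom m Y w hY) with h | h
      · refine Or.inr (hBker m Y w ⟨hY.1, fun q hq => ?_⟩)
        have hle : J' ≤ LinearMap.ker (rowEval Y w) :=
          sup_le (fun q hq => hY.2 q hq)
            (Submodule.span_le.2 (by rintro _ ⟨k, rfl⟩; exact h k))
        exact hle hq
      · exact Or.inl h
    · refine ⟨1, 0, le_rfl, by simp, fun m Y _ V => ?_, fun m Y w hY =>
        absurd ⟨m, (Y, w), hY⟩ hne⟩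
      simpa using (posSemidef_transpose_mul_self V).trace_nonneg

/-! ### The pencil on the closure and the final identification -/

theorem ncEval_monicPencil {g l n : ℕ} (A : Fin g → Matrix (Fin l) (Fin l) ℝ)
    (X : SymTuple g n) : ncEval (monicPencil A) X = 1 + ∑ j, A j ⊗ₖ X.1 j := by
  ext ⟨i, a⟩ ⟨k, b⟩
  simp only [ncEval, monicPencil, Matrix.of_apply, Matrix.add_apply, Matrix.sum_apply,
    Matrix.map_apply, map_add, map_sum, map_smul, FreeAlgebra.lift_ι_apply, Matrix.smul_apply,
    smul_eq_mul, Matrix.kroneckerMap_apply]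
  congr 1
  by_cases h : i = k
  · subst h
    simp [Matrix.one_apply]
  · simp [h]

/-- Under vectorisation, kernel vectors of `L(X)` are the matrix solutions of `V + ∑ X_j V A_j = 0`,
the form in which the pencils were built. -/
theorem ncEval_monicPencil_mulVec_vec {g l n : ℕ} {A : Fin g → Matrix (Fin l) (Fin l) ℝ}
    (hA : ∀ j, (A j)ᵀ = A j) (X : SymTuple g n) (V : Matrix (Fin n) (Fin l) ℝ) :
    ncEval (monicPencil A) X *ᵥ V.vec = (V + ∑ j, X.1 j * V * A j).vec := by
  rw [ncEval_monicPencil, Matrix.add_mulVec, Matrix.one_mulVec, Matrix.sum_mulVec, Matrix.vec_add,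
    Matrix.vec_sum]
  congr 1
  refine Finset.sum_congr rfl fun j _ => ?_
  rw [Matrix.kronecker_mulVec_vec, hA]

theorem isHermitian_ncEval_monicPencil {g l n : ℕ} {A : Fin g → Matrix (Fin l) (Fin l) ℝ}
    (hA : ∀ j, (A j)ᵀ = A j) (X : SymTuple g n) : (ncEval (monicPencil A) X).IsHermitian := by
  rw [ncEval_monicPencil, Matrix.IsHermitian, Matrix.conjTranspose_eq_transpose_of_trivial,
    Matrix.transpose_add, Matrix.transpose_one, Matrix.transpose_sum]
  congr 1
  refine Finset.sum_congr rfl fun j _ => ?_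
  rw [← Matrix.kroneckerMap_transpose, hA, show (X.1 j)ᵀ = X.1 j from X.2 j]

theorem posSemidef_ncEval_monicPencil {g δ l n : ℕ} {p : NCMatPoly g δ}
    {A : Fin g → Matrix (Fin l) (Fin l) ℝ} (hA : ∀ j, (A j)ᵀ = A j) (hpos : PencilNonneg p A)
    {X : SymTuple g n} (hX : X ∈ closure (invertibilitySet p n)) :
    (ncEval (monicPencil A) X).PosSemidef := by
  refine Matrix.PosSemidef.of_dotProduct_mulVec_nonneg (isHermitian_ncEval_monicPencil hA X)
    fun u => ?_
  obtain ⟨V, rfl⟩ : ∃ V : Matrix (Fin n) (Fin l) ℝ, V.vec = u :=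
    ⟨Matrix.of fun a i => u (i, a), rfl⟩
  rw [ncEval_monicPencil_mulVec_vec hA, star_trivial, Matrix.vec_dotProduct_vec, Matrix.mul_add,
    Matrix.trace_add, Matrix.mul_sum, Matrix.trace_sum]
  refine (hpos n X hX V).trans_eq ?_
  congr 1
  refine Finset.sum_congr rfl fun j _ => ?_
  rw [Matrix.trace_mul_comm]
  simp only [Matrix.mul_assoc]

theorem ncEval_monicPencil_smul {g l n : ℕ} (A : Fin g → Matrix (Fin l) (Fin l) ℝ)
    (t : ℝ) (X : SymTuple g n) :
    ncEval (monicPencil A) (t • X) = t • ncEval (monicPencil A) X + (1 - t) • 1 := by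
  have : ∀ j, (t • X).1 j = t • X.1 j := fun _ => rfl
  simp only [ncEval_monicPencil, this, Matrix.kronecker_smul, ← Finset.smul_sum]
  module

/-- A closure point of the invertibility set outside of it carries a kernel vector. -/
theorem exists_isBoundaryPair {g δ n : ℕ} {p : NCMatPoly g δ} (hp0 : IsUnit (constTerm p))
    {X : SymTuple g n} (hX : X ∈ closure (invertibilitySet p n))
    (hX' : X ∉ invertibilitySet p n) : ∃ v, IsBoundaryPair p X v := by
  have hunit : ¬ IsUnit (ncEval p X) := by
    intro h
    refine hX' ?_
    -- Adjoining a closure point keeps the set connected; were `p(X)` invertible, `X` would belong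
    -- to the component.
    have hpre : IsPreconnected (insert X (invertibilitySet p n)) :=
      (isPreconnected_invertibilitySet p n).subset_closure (Set.subset_insert _ _)
        (Set.insert_subset hX subset_closure)
    refine hpre.subset_connectedComponentIn (F := {X : SymTuple g n | IsUnit (ncEval p X)})
      (Set.mem_insert_of_mem _ (zero_mem_invertibilitySet hp0 n)) ?_ (Set.mem_insert _ _)
    rintro Y (rfl | hY)
    · exact h
    · exact isUnit_of_mem_invertibilitySet hY
  obtain ⟨v, hv, h⟩ := not_isUnit_ncEval_iff.1 hunit
  exact ⟨v, hX, hv, h⟩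

/-- By openness `(1 + s)X` is still in the set for some `s > 0`, and `L(X)` is a convex combination
of `L((1 + s)X) ⪰ 0` and the identity, the latter with positive weight. -/
theorem posDef_of_mem_invertibilitySet {g δ l n : ℕ} {p : NCMatPoly g δ}
    {A : Fin g → Matrix (Fin l) (Fin l) ℝ} (hA : ∀ j, (A j)ᵀ = A j) (hpos : PencilNonneg p A)
    {X : SymTuple g n} (hX : X ∈ invertibilitySet p n) :
    (ncEval (monicPencil A) X).PosDef := by
  have hc : Continuous fun s : ℝ => (1 + s) • X := by fun_prop
  have hev : ∀ᶠ s in nhds (0 : ℝ), (1 + s) • X ∈ invertibilitySet p n :=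
    hc.continuousAt.eventually_mem (by
      simpa using (isOpen_invertibilitySet p n).mem_nhds hX)
  obtain ⟨s, hs, hs0⟩ := ((hev.filter_mono nhdsWithin_le_nhds).and
    (self_mem_nhdsWithin : Set.Ioi (0 : ℝ) ∈ nhdsWithin 0 (Set.Ioi 0))).exists
  have hs0 : 0 < s := hs0
  have h1 := posSemidef_ncEval_monicPencil hA hpos (subset_closure hs)
  have h2 : X = (1 + s)⁻¹ • ((1 + s) • X) := by
    rw [smul_smul, inv_mul_cancel₀ (by positivity), one_smul]
  rw [h2, ncEval_monicPencil_smul]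
  have h3 : 0 < 1 - (1 + s)⁻¹ := by
    rw [sub_pos]
    exact inv_lt_one_of_one_lt₀ (by linarith)
  exact Matrix.PosDef.posSemidef_add
    (Matrix.PosSemidef.smul h1 (by positivity : (0 : ℝ) ≤ (1 + s)⁻¹)) (Matrix.PosDef.one.smul h3)

/-- `L` is positive definite along the segment from 0 to `X`, so the segment cannot meet the
boundary, where `L` is singular. -/
theorem mem_invertibilitySet_of_posDef {g δ l n : ℕ} {p : NCMatPoly g δ}
    (hp0 : IsUnit (constTerm p)) {A : Fin g → Matrix (Fin l) (Fin l) ℝ}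
    (hsing : ∀ (X : SymTuple g n) (v : Fin δ → Fin n → ℝ), IsBoundaryPair p X v →
      ∃ u : Fin l × Fin n → ℝ, u ≠ 0 ∧ ncEval (monicPencil A) X *ᵥ u = 0)
    {X : SymTuple g n} (hX : (ncEval (monicPencil A) X).PosDef) : X ∈ invertibilitySet p n := by
  refine (convex_segment (𝕜 := ℝ) 0 X).isPreconnected.subset_of_closure_inter_subset
    (isOpen_invertibilitySet p n)
    ⟨0, left_mem_segment ℝ 0 X, zero_mem_invertibilitySet hp0 n⟩ ?_ (right_mem_segment ℝ 0 X)
  rintro Z ⟨hZ, hZseg⟩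
  by_contra hZ'
  obtain ⟨v, hv⟩ := exists_isBoundaryPair hp0 hZ hZ'
  obtain ⟨u, hu, hu0⟩ := hsing Z v hv
  rw [segment_eq_image] at hZseg
  obtain ⟨t, ⟨ht0, ht1⟩, rfl⟩ := hZseg
  have hpd : (ncEval (monicPencil A) (t • X)).PosDef := by
    rw [ncEval_monicPencil_smul]
    rcases ht0.eq_or_lt with rfl | ht
    · simpa using Matrix.PosDef.one
    · exact (hX.smul ht).add_posSemidef (Matrix.PosSemidef.one.smul (by linarith))
  have := hpd.dotProduct_mulVec_pos hu
  simp only [smul_zero, zero_add] at hu0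
  rw [hu0, dotProduct_zero] at this
  exact lt_irrefl _ this

/-- The construction of the pencil uses neither the symmetry of `p` nor the boundedness of its
invertibility set. -/
theorem theorem1p1 (g δ : ℕ) (p : NCMatPoly g δ) (hsymm : p.IsHermitian)
    (hp0 : IsUnit (constTerm p))
    (hbdd : HasBoundedInvertibilitySet p)
    (hconv : HasConvexInvertibilitySet p) :
    ∃ (l : ℕ) (A : Fin g → Matrix (Fin l) (Fin l) ℝ),
      1 ≤ l ∧ (∀ j, (A j).IsSymm) ∧
      ∀ n : ℕ, 1 ≤ n →
        invertibilitySet p n = invertibilitySet (monicPencil A) n ∧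
        invertibilitySet p n = {X : SymTuple g n | (ncEval (monicPencil A) X).PosDef} ∧
        ∀ X ∈ frontier (invertibilitySet p n),
          ∃ v : Fin l × Fin n → ℝ, v ≠ 0 ∧ (ncEval (monicPencil A) X).mulVec v = 0 := by
  obtain ⟨d, hd⟩ := exists_forall_mem_ncDegreeLE p
  obtain ⟨l, A, hl, hA, hpos, hker⟩ := exists_pencil_of_annihilatedPairs hp0 hconv hd
    -- Starting from `J = ⊥` imposes no condition, so all boundary pairs are covered.
    (Module.finrank ℝ (rowDegreeLE g δ d)) ⊥ bot_le (Nat.le_add_left _ _)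
  refine ⟨l, A, hl, hA, fun n _ => ?_⟩
  have hsing : ∀ (X : SymTuple g n) (v : Fin δ → Fin n → ℝ), IsBoundaryPair p X v →
      ∃ u : Fin l × Fin n → ℝ, u ≠ 0 ∧ ncEval (monicPencil A) X *ᵥ u = 0 := by
    intro X v hv
    obtain ⟨V, hV, hV0⟩ := hker n X v ⟨hv, fun q hq => by
      rw [(Submodule.mem_bot ℝ).1 hq, map_zero]⟩
    refine ⟨V.vec, fun h => hV ?_, ?_⟩
    · exact Matrix.vec_inj.1 (h.trans Matrix.vec_zero.symm)
    · rw [ncEval_monicPencil_mulVec_vec hA, hV0, Matrix.vec_zero]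
  have heq : invertibilitySet p n = {X : SymTuple g n | (ncEval (monicPencil A) X).PosDef} :=
    Set.Subset.antisymm (fun X hX => posDef_of_mem_invertibilitySet hA hpos hX)
      (fun X hX => mem_invertibilitySet_of_posDef hp0 hsing hX)
  have h0 := zero_mem_invertibilitySet (g := g) hp0 n
  have hsub : invertibilitySet p n ⊆ invertibilitySet (monicPencil A) n :=
    (isPreconnected_invertibilitySet p n).subset_connectedComponentIn h0 fun X hX =>
      (posDef_of_mem_invertibilitySet hA hpos hX).isUnit
  refine ⟨hsub.antisymm ?_, heq, fun X hX => ?_⟩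
  -- In the closure of `D_p` the pencil is semidefinite, so where it is invertible it is definite:
  -- `D_p` is relatively closed in the connected set `D_L`.
  · refine (isPreconnected_invertibilitySet _ n).subset_of_closure_inter_subset
      (isOpen_invertibilitySet p n) ⟨0, hsub h0, h0⟩ ?_
    rintro X ⟨hX, hX'⟩
    exact mem_invertibilitySet_of_posDef hp0 hsing
      ((posSemidef_ncEval_monicPencil hA hpos hX).posDef_iff_isUnit.2
        (isUnit_of_mem_invertibilitySet hX'))
  · rw [(isOpen_invertibilitySet p n).frontier_eq] at hX
    obtain ⟨v, hv⟩ := exists_isBoundaryPair hp0 hX.1 hX.2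
    exact hsing X v hv
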